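/- Let $n=n_x$ and $m=n_u$ be non-negative integers. Let $f:\mathbb R^{n}\times\mathbb R^{m}\to\mathbb R^{n}$ be twice continuously differentiable and globally Lipschitz in $x$ for every $u$, let $l:\mathbb R^{n}\times\mathbb R^{m}\to\mathbb R$ be twice continuously differentiable, and put $H(x,u,\lambda)=\lambda^{\top}f(x,u)+l(x,u)$. Let $u^\star(x,\lambda)$ be a minimizer of $u\mapsto H(x,u,\lambda)$ with $H_{uu}(x,u^\star(x,\lambda),\lambda)\succ 0$, for all $(x,\lambda)$. Let $$F(x,\lambda)=\bigl(f(x,u^\star(x,\lambda)),\,-\nabla_x H(x,u^\star(x,\lambda),\lambda)\bigr)$$ be the vector field of Pontryagin's differential equation on $\mathbb R^{2n}$, and let $\Omega=\begin{pmatrix}0&I\\-I&0\end{pmatrix}\in\mathbb R^{2n\times 2n}$. Let $D$ be either $\mathbb R^{2n}$ or a region of interest, that is, an open set $D\subseteq\mathbb R^{2n}$ on which $u^\star$ is continuous and such that through every point of $D$ there is a solution $y:\mathbb R\to D$ of $\dot y=F(y)$. Let $W_{k,2}(D)$ be the Sobolev space of complex-valued functions on $D$ whose weak derivatives up to order $k$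 are square integrable, and for $\varphi,\Phi\in W_{1,2}(D)$ put $$\omega(\varphi,\Phi)=\int_D\nabla\varphi(z)^{\top}\,\Omega\,\nabla\Phi(z)\,\mathrm dz$$ (complex bilinear, no conjugation). Let $L\Phi=F^{\top}\nabla\Phi$, and let $\sigma(L)\subseteq\mathbb C$ be the set of eigenvalues of $L$, that is, of all $\kappa\in\mathbb C$ for which there is a $\Psi\in W_{2,2}(D)$, not zero almost everywhere, with $F^{\top}\nabla\Psi=\kappa\Psi$ almost everywhere on $D$. Let $q=(q_1,\dots,q_{2n})$ with $q_i\in W_{1,2}(D)$ be skew-orthogonal, that is, $\bigl(\omega(q_i,q_j)\bigr)_{i,j}=\Omega$. Suppose that $L$ admits a spectral decomposition with respect to $q$: there are eigenfunctions $\Psi_\kappa\in W_{2,2}(D)$ of $L$, one for each $\kappa\in\sigma(L)$, and a distribution of order zero $a$ on $\sigma(L)$ with values in $\mathbb C^{2n}$ that is bounded in the sup norm (a finite $\mathbb C^{2n}$-valued Borel measure carried by $\sigma(L)$), such that $$q=\int_{\sigma(L)}\Psi_\kappa\,a(\mathrm d\kappa)$$ as a weak integral in $W_{1,2}(D)$,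 i.e. $\kappa\mapsto\ell(\Psi_\kappa)$ is integrable and $\ell(q_j)=\int_{\sigma(L)}\ell(\Psi_\kappa)\,a_j(\mathrm d\kappa)$ for every $j$ and every continuous linear functional $\ell$ on $W_{1,2}(D)$. Then $\sigma(L)$ contains at least $2n$ eigenvalues in mirrored pairs: there are $2n$ pairwise distinct eigenvalues $\kappa_1^+,\dots,\kappa_n^+,\kappa_1^-,\dots,\kappa_n^-\in\sigma(L)$ with $\kappa_i^+=-\kappa_i^-$ and $\operatorname{Re}\kappa_i^+\ge 0$ for all $i\in\{1,\dots,n\}$. -/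

import Mathlib

open MeasureTheory
open scoped ContDiff

noncomputable section

namespace PontryaginKoopman

/-- Phase space `ℝ^{2n}` with its Euclidean norm and Lebesgue measure. The coordinates `Sum.inl i`
are those of the state `x`, the coordinates `Sum.inr i` are those of the co-state `lam`. -/
abbrev Phase (n : ℕ) : Type := EuclideanSpace ℝ (Fin n ⊕ Fin n)

/-- The state part `x` of `z = (x, lam)`. -/
def stateOf {n : ℕ} (z : Phase n) : EuclideanSpace ℝ (Fin n) :=
  WithLp.toLp 2 fun i => z (Sum.inl i)

/-- The co-state part `lam` of `z = (x, lam)`. -/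
def costateOf {n : ℕ} (z : Phase n) : EuclideanSpace ℝ (Fin n) :=
  WithLp.toLp 2 fun i => z (Sum.inr i)

section OptimalControl

variable {n m : ℕ}

/-- The Hamiltonian `H(x, u, lam) = lamᵀ f(x, u) + l(x, u)`. -/
def hamiltonian (f : EuclideanSpace ℝ (Fin n) → EuclideanSpace ℝ (Fin m) →
      EuclideanSpace ℝ (Fin n))
    (l : EuclideanSpace ℝ (Fin n) → EuclideanSpace ℝ (Fin m) → ℝ)
    (x : EuclideanSpace ℝ (Fin n)) (u : EuclideanSpace ℝ (Fin m))
    (lam : EuclideanSpace ℝ (Fin n)) : ℝ :=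
  inner ℝ lam (f x u) + l x u

/-- The dynamics `f` is twice continuously differentiable, and globally Lipschitz in `x`
(the Lipschitz constant may depend on the control value). -/
structure DynamicsAssumption (f : EuclideanSpace ℝ (Fin n) → EuclideanSpace ℝ (Fin m) →
    EuclideanSpace ℝ (Fin n)) : Prop where
  contDiff : ContDiff ℝ 2 (Function.uncurry f)
  lipschitz : ∀ u, ∃ K, LipschitzWith K fun x => f x u

/-- The stage cost `l` is twice continuously differentiable. -/
def CostAssumption (l : EuclideanSpace ℝ (Fin n) → EuclideanSpace ℝ (Fin m) → ℝ) : Prop :=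
  ContDiff ℝ 2 (Function.uncurry l)

/-- `us x lam` is a (global) minimizer of `u ↦ H(x, u, lam)` at which the second order sufficient
condition `H_uu ≻ 0` holds. -/
structure MinimizerAssumption (f : EuclideanSpace ℝ (Fin n) → EuclideanSpace ℝ (Fin m) →
      EuclideanSpace ℝ (Fin n))
    (l : EuclideanSpace ℝ (Fin n) → EuclideanSpace ℝ (Fin m) → ℝ)
    (us : EuclideanSpace ℝ (Fin n) → EuclideanSpace ℝ (Fin n) →
      EuclideanSpace ℝ (Fin m)) : Prop where
  isMin : ∀ x lam u, hamiltonian f l x (us x lam) lam ≤ hamiltonian f l x u lam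
  hessian_pos : ∀ x lam v, v ≠ 0 →
    0 < fderiv ℝ (fun u => fderiv ℝ (fun w => hamiltonian f l x w lam) u) (us x lam) v v

/-- The right-hand side `F` of Pontryagin's differential equation
`x' = f(x, us(x, lam))`, `lam' = -∇ₓ H(x, us(x, lam), lam)`. -/
def pontryaginField (f : EuclideanSpace ℝ (Fin n) → EuclideanSpace ℝ (Fin m) →
      EuclideanSpace ℝ (Fin n))
    (l : EuclideanSpace ℝ (Fin n) → EuclideanSpace ℝ (Fin m) → ℝ)
    (us : EuclideanSpace ℝ (Fin n) → EuclideanSpace ℝ (Fin n) →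
      EuclideanSpace ℝ (Fin m)) (z : Phase n) : Phase n :=
  WithLp.toLp 2 <| Sum.elim
    (fun i => f (stateOf z) (us (stateOf z) (costateOf z)) i)
    (fun i => -(gradient (fun ξ => hamiltonian f l ξ (us (stateOf z) (costateOf z)) (costateOf z))
      (stateOf z) i))

/-- The whole phase space, or a region of interest: an open set `D` that is invariant under the flow
of Pontryagin's differential equation (every point of `D` lies on a solution which exists for all
times and stays in `D`) and on which the parametric minimizer is continuous. -/
def IsRegion (f : EuclideanSpace ℝ (Fin n) → EuclideanSpace ℝ (Fin m) →
      EuclideanSpace ℝ (Fin n))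
    (l : EuclideanSpace ℝ (Fin n) → EuclideanSpace ℝ (Fin m) → ℝ)
    (us : EuclideanSpace ℝ (Fin n) → EuclideanSpace ℝ (Fin n) →
      EuclideanSpace ℝ (Fin m)) (D : Set (Phase n)) : Prop :=
  D = Set.univ ∨
    (IsOpen D ∧ ContinuousOn (fun z => us (stateOf z) (costateOf z)) D ∧
      ∀ z ∈ D, ∃ y : ℝ → Phase n, y 0 = z ∧
        ∀ t, y t ∈ D ∧ HasDerivAt y (pontryaginField f l us (y t)) t)

end OptimalControl

section Sobolev

variable {n : ℕ}

/-- Complex-valued square integrable functions on `D`. -/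
abbrev L2 (D : Set (Phase n)) : Type := Lp ℂ 2 ((volume : Measure (Phase n)).restrict D)

/-- `ψ` is the weak partial derivative of `φ` on `D` in the `i`-th coordinate direction. -/
def IsWeakPartial (D : Set (Phase n)) (i : Fin n ⊕ Fin n) (φ ψ : L2 D) : Prop :=
  ∀ χ : Phase n → ℝ, ContDiff ℝ ∞ χ → HasCompactSupport χ → tsupport χ ⊆ D →
    ∫ z in D, fderiv ℝ χ z (EuclideanSpace.single i 1) • φ z = -∫ z in D, χ z • ψ z

theorem integrable_smul_L2 (D : Set (Phase n)) (φ : L2 D) {χ : Phase n → ℝ}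
    (hχ : Continuous χ) (hc : HasCompactSupport χ) :
    Integrable (fun z => χ z • φ z) (volume.restrict D) :=
  ((Lp.memLp φ).locallyIntegrable (by norm_num)).integrable_smul_left_of_hasCompactSupport hχ hc

theorem continuous_partial {χ : Phase n → ℝ} (hχ : ContDiff ℝ ∞ χ) (v : Phase n) :
    Continuous fun z => fderiv ℝ χ z v :=
  (hχ.continuous_fderiv (by simp)).clm_apply continuous_const

theorem hasCompactSupport_partial {χ : Phase n → ℝ} (hc : HasCompactSupport χ) (v : Phase n) :
    HasCompactSupport fun z => fderiv ℝ χ z v :=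
  hc.fderiv_apply (𝕜 := ℝ) v

/-- The Sobolev space `W_{1,2}(D)` of complex-valued functions. An element is a square integrable
function `φ` together with its weak gradient `(∂ᵢ φ)ᵢ`, which has square integrable components;
the norm is the maximum of the `L²` norms of `φ` and of the `∂ᵢ φ`. -/
def W12 (D : Set (Phase n)) : Submodule ℂ (L2 D × (Fin n ⊕ Fin n → L2 D)) where
  carrier := {p | ∀ i, IsWeakPartial D i p.1 (p.2 i)}
  zero_mem' := by
    intro i χ _ _ _
    have h : (fun z => fderiv ℝ χ z (EuclideanSpace.single i 1) • ((0 : L2 D) : Phase n → ℂ) z)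
        =ᵐ[volume.restrict D] fun _ => (0 : ℂ) := by
      filter_upwards [Lp.coeFn_zero ℂ 2 (volume.restrict D)] with z hz
      simp only [hz, Pi.zero_apply, smul_zero]
    have h' : (fun z => χ z • ((0 : L2 D) : Phase n → ℂ) z)
        =ᵐ[volume.restrict D] fun _ => (0 : ℂ) := by
      filter_upwards [Lp.coeFn_zero ℂ 2 (volume.restrict D)] with z hz
      simp only [hz, Pi.zero_apply, smul_zero]
    change ∫ z in D, fderiv ℝ χ z (EuclideanSpace.single i 1) • ((0 : L2 D) : Phase n → ℂ) z =
      -∫ z in D, χ z • ((0 : L2 D) : Phase n → ℂ) z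
    rw [integral_congr_ae h, integral_congr_ae h']
    simp
  add_mem' := by
    rintro p q hp hq i χ hχ hc hD
    have h : (fun z => fderiv ℝ χ z (EuclideanSpace.single i 1) • (p.1 + q.1 : L2 D) z)
        =ᵐ[volume.restrict D] fun z => fderiv ℝ χ z (EuclideanSpace.single i 1) • p.1 z +
          fderiv ℝ χ z (EuclideanSpace.single i 1) • q.1 z := by
      filter_upwards [Lp.coeFn_add p.1 q.1] with z hz
      simp only [hz, Pi.add_apply, smul_add]
    have h' : (fun z => χ z • (p.2 i + q.2 i : L2 D) z)
        =ᵐ[volume.restrict D] fun z => χ z • p.2 i z + χ z • q.2 i z := by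
      filter_upwards [Lp.coeFn_add (p.2 i) (q.2 i)] with z hz
      simp only [hz, Pi.add_apply, smul_add]
    change ∫ z in D, fderiv ℝ χ z (EuclideanSpace.single i 1) • (p.1 + q.1 : L2 D) z =
      -∫ z in D, χ z • (p.2 i + q.2 i : L2 D) z
    rw [integral_congr_ae h, integral_congr_ae h',
      integral_add (integrable_smul_L2 D _ (continuous_partial hχ _) (hasCompactSupport_partial hc _))
        (integrable_smul_L2 D _ (continuous_partial hχ _) (hasCompactSupport_partial hc _)),
      integral_add (integrable_smul_L2 D _ hχ.continuous hc)
        (integrable_smul_L2 D _ hχ.continuous hc), hp i χ hχ hc hD, hq i χ hχ hc hD]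
    ring
  smul_mem' := by
    rintro c p hp i χ hχ hc hD
    have h : (fun z => fderiv ℝ χ z (EuclideanSpace.single i 1) • (c • p.1 : L2 D) z)
        =ᵐ[volume.restrict D]
          fun z => c • (fderiv ℝ χ z (EuclideanSpace.single i 1) • p.1 z) := by
      filter_upwards [Lp.coeFn_smul c p.1] with z hz
      simp only [hz, Pi.smul_apply]
      exact smul_comm _ _ _
    have h' : (fun z => χ z • (c • p.2 i : L2 D) z)
        =ᵐ[volume.restrict D] fun z => c • (χ z • p.2 i z) := by
      filter_upwards [Lp.coeFn_smul c (p.2 i)] with z hz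
      simp only [hz, Pi.smul_apply]
      exact smul_comm _ _ _
    change ∫ z in D, fderiv ℝ χ z (EuclideanSpace.single i 1) • (c • p.1 : L2 D) z =
      -∫ z in D, χ z • (c • p.2 i : L2 D) z
    rw [integral_congr_ae h, integral_congr_ae h', integral_smul, integral_smul,
      hp i χ hχ hc hD, smul_neg]

/-- The function (class) underlying an element of `W_{1,2}(D)`. -/
def fnOf {D : Set (Phase n)} (φ : W12 D) : L2 D := φ.1.1

/-- The weak partial derivatives of an element of `W_{1,2}(D)`. -/
def gradOf {D : Set (Phase n)} (φ : W12 D) (i : Fin n ⊕ Fin n) : L2 D := φ.1.2 i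

/-- `φ ∈ W_{2,2}(D)`: all weak partial derivatives of `φ` lie in `W_{1,2}(D)`. -/
def MemW22 {D : Set (Phase n)} (φ : W12 D) : Prop :=
  ∀ i, ∃ w : W12 D, fnOf w = gradOf φ i

/-- The block matrix `Ω = [[0, I], [-I, 0]]`. -/
def Omega (n : ℕ) : Matrix (Fin n ⊕ Fin n) (Fin n ⊕ Fin n) ℂ :=
  Matrix.fromBlocks 0 1 (-1) 0

/-- The (complex bilinear, skew-symmetric) form `ω(φ, Φ) = ∫_D ∇φ(z)ᵀ Ω ∇Φ(z) dz` on
`W_{1,2}(D)`. -/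
def omega {D : Set (Phase n)} (φ Φ : W12 D) : ℂ :=
  ∫ z in D, ∑ i, ∑ j, gradOf φ i z * Omega n i j * gradOf Φ j z

/-- `q = (q_i)` is skew-orthogonal: the matrix `ω(q, q) = (ω(q_i, q_j))_{i,j}` is the standard
skew-symmetric unit matrix `Ω`. -/
def IsSkewOrthogonal {D : Set (Phase n)} (q : Fin n ⊕ Fin n → W12 D) : Prop :=
  ∀ i j, omega (q i) (q j) = Omega n i j

/-- `Ψ ∈ W_{2,2}(D)` is an eigenfunction of `L Φ = Fᵀ ∇Φ` for the eigenvalue `κ`: it does not vanish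
almost everywhere and `Fᵀ ∇Ψ = κ Ψ` almost everywhere on `D`. -/
structure IsEigenfunction (F : Phase n → Phase n) (D : Set (Phase n)) (κ : ℂ) (Ψ : W12 D) :
    Prop where
  memW22 : MemW22 Ψ
  ne_zero : fnOf Ψ ≠ 0
  eigen : ∀ᵐ z ∂(volume.restrict D), ∑ i, ((F z i : ℝ) : ℂ) * gradOf Ψ i z = κ * fnOf Ψ z

/-- The spectrum `σ(L)`: the set of all eigenvalues of `L Φ = Fᵀ ∇Φ` on `D`. -/
def pointSpectrum (F : Phase n → Phase n) (D : Set (Phase n)) : Set ℂ :=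
  {κ | ∃ Ψ : W12 D, IsEigenfunction F D κ Ψ}

/-- `L` admits a spectral decomposition `q = ∫_{σ(L)} Ψ_κ a(κ) dκ`. Here `Ψ_κ` is an eigenfunction
for each `κ ∈ σ(L)`, and `a = (a_j)` is a `ℂ^{2n}`-valued distribution of order zero on `σ(L)`, bounded
in the sup norm, that is, a vector of (finite) complex Borel measures carried by `σ(L)`. The integral
is the weak integral in `W_{1,2}(D)`, that is, it is tested with all continuous linear
functionals. -/
def AdmitsSpectralDecomposition (F : Phase n → Phase n) (D : Set (Phase n))
    (q : Fin n ⊕ Fin n → W12 D) : Prop :=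
  ∃ (Ψ : ℂ → W12 D) (a : Fin n ⊕ Fin n → ComplexMeasure ℂ),
    (∀ κ ∈ pointSpectrum F D, IsEigenfunction F D κ (Ψ κ)) ∧
    (∀ j, (a j).variation (pointSpectrum F D)ᶜ = 0) ∧
    ∀ (j : Fin n ⊕ Fin n) (ℓ : W12 D →L[ℂ] ℂ),
      (a j).Integrable (fun κ => ℓ (Ψ κ)) ∧
      ℓ (q j) = (a j).integral (fun κ => ℓ (Ψ κ)) (ContinuousLinearMap.mul ℝ ℂ)

end Sobolev

end PontryaginKoopman

end

/-! Pontryagin's field is Hamiltonian: F = Ω∇h, where h is the minimized Hamiltonian. Hence L is the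
Poisson bracket with h and formally skew-adjoint for ω, so eigenfunctions for κ and μ satisfy (κ +
μ) ω(Ψ_κ, Ψ_μ) = 0. If ω(Ψ_κ, ·) is not zero on q, the decomposition gives some μ ∈ σ(L) with ω(Ψ_κ,
Ψ_μ) ≠ 0, so μ = -κ; and κ ≠ 0 because ω(Ψ_0, Ψ_0) = 0. The vectors (ω(Ψ_κ, q_j))_j span ℂ^{2n},
because a combination of the q_j that is ω-orthogonal to every Ψ_κ is ω-orthogonal to q, and Ω is
nondegenerate. So at least 2n eigenvalues lie in pairs {κ, -κ} (`exists_mirrored_pairs`).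

The analytic content is the relation (κ + μ) ω = 0. The Jacobi identity, integrated by parts against
a cutoff χ, gives an identity with only first derivatives of the two functions
(`integral_poisson_cyclic`). Mollification carries it to W_{1,2}, and on eigenfunctions it reads (κ
+ μ) ∫ χ {φ, ψ} = -∫ {φ, ψ} {χ, h} (`eigen_integral_weakPoisson`). It remains to let χ tend to 1
while {χ, h}, the derivative of χ along F, tends to 0 boundedly. As F may be unbounded, ordinary
cutoffs do not suffice; averaging a cutoff η over unit time along the flow gives a function with
derivative η(y(1)) - η(y(0)) along an orbit y (`exists_flow_average`).

On a region of interest the regularity of h and F comes from the implicit function theorem and the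
envelope theorem. On the whole space none of this is needed: cutoffs with gradients tending
uniformly to zero show that ω vanishes identically (`omega_eq_zero_of_univ`). -/

noncomputable section

namespace PontryaginKoopman

open Filter Topology Set Convolution ContinuousLinearMap
open scoped ENNReal NNReal

/-! ### Mollification in L² -/

section Mollification

variable {E : Type*} [NormedAddCommGroup E] [NormedSpace ℝ E] [FiniteDimensional ℝ E]
  [MeasurableSpace E] [BorelSpace E] {μ : Measure E} [μ.IsAddHaarMeasure]

/-- Jensen's inequality for the square, on a probability space. -/
theorem sq_lintegral_le_lintegral_sq {α : Type*} [MeasurableSpace α] (ν : Measure α)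
    [IsProbabilityMeasure ν] {g : α → ℝ≥0∞} (hg : AEMeasurable g ν) :
    (∫⁻ t, g t ∂ν) ^ (2 : ℝ) ≤ ∫⁻ t, g t ^ (2 : ℝ) ∂ν := by
  have h := ENNReal.lintegral_mul_le_Lp_mul_Lq ν (Real.HolderConjugate.two_two) hg
    (aemeasurable_const (b := (1 : ℝ≥0∞)))
  simp only [Pi.mul_apply, mul_one, ENNReal.one_rpow, lintegral_one, measure_univ] at h
  calc (∫⁻ t, g t ∂ν) ^ (2 : ℝ) ≤ ((∫⁻ t, g t ^ (2 : ℝ) ∂ν) ^ (1 / 2 : ℝ)) ^ (2 : ℝ) := by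
        gcongr
    _ = ∫⁻ t, g t ^ (2 : ℝ) ∂ν := by
        rw [← ENNReal.rpow_mul]; norm_num

theorem eLpNorm_two_sq {α F : Type*} [MeasurableSpace α] [NormedAddCommGroup F] (ν : Measure α)
    (f : α → F) : eLpNorm f 2 ν ^ (2 : ℝ) = ∫⁻ t, ‖f t‖ₑ ^ (2 : ℝ) ∂ν := by
  have := eLpNorm_nnreal_pow_eq_lintegral (μ := ν) (f := f) (p := 2) (by norm_num)
  simpa using this

/-- Convolution with a normalized bump function is a contraction of `L²`. -/
theorem eLpNorm_normed_convolution_le (φ : ContDiffBump (0 : E)) {f : E → ℂ}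
    (hf : Measurable f) :
    eLpNorm (φ.normed μ ⋆[lsmul ℝ ℝ, μ] f) 2 μ ≤ eLpNorm f 2 μ := by
  rw [← ENNReal.rpow_le_rpow_iff (z := (2 : ℝ)) (by norm_num), eLpNorm_two_sq, eLpNorm_two_sq]
  have hρ : Measurable fun t => ‖φ.normed μ t‖ₑ := φ.continuous_normed.measurable.enorm
  -- The kernel is the density of a probability measure, so Jensen bounds the squared convolution at
  -- x by the ν-average of |f(x - t)|²; Tonelli and translation invariance then remove t.
  set ν : Measure E := μ.withDensity fun t => ‖φ.normed μ t‖ₑ with hν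
  have : IsProbabilityMeasure ν := by
    constructor
    rw [hν, withDensity_apply _ MeasurableSet.univ, Measure.restrict_univ]
    have h1 : ∫⁻ t, ‖φ.normed μ t‖ₑ ∂μ = ENNReal.ofReal (∫ t, φ.normed μ t ∂μ) := by
      rw [ofReal_integral_eq_lintegral_ofReal φ.integrable_normed
        (Eventually.of_forall φ.nonneg_normed)]
      exact lintegral_congr fun t => Real.enorm_of_nonneg (φ.nonneg_normed t)
    rw [h1, φ.integral_normed, ENNReal.ofReal_one]
  have hsub : Measurable fun p : E × E => ‖f (p.1 - p.2)‖ₑ :=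
    (hf.comp (measurable_fst.sub measurable_snd)).enorm
  calc ∫⁻ x, ‖(φ.normed μ ⋆[lsmul ℝ ℝ, μ] f) x‖ₑ ^ (2 : ℝ) ∂μ
      ≤ ∫⁻ x, ∫⁻ t, ‖f (x - t)‖ₑ ^ (2 : ℝ) ∂ν ∂μ := by
        refine lintegral_mono fun x => ?_
        have hx : Measurable fun t => ‖f (x - t)‖ₑ := hsub.comp (measurable_const.prodMk measurable_id)
        refine le_trans ?_ (sq_lintegral_le_lintegral_sq ν hx.aemeasurable)
        gcongr
        rw [hν, lintegral_withDensity_eq_lintegral_mul _ hρ hx, convolution_def]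
        refine (enorm_integral_le_lintegral_enorm _).trans_eq ?_
        refine lintegral_congr fun t => ?_
        rw [lsmul_apply, enorm_smul, Pi.mul_apply]
    _ = ∫⁻ t, ∫⁻ x, ‖f (x - t)‖ₑ ^ (2 : ℝ) ∂μ ∂ν :=
        lintegral_lintegral_swap (hsub.pow_const _).aemeasurable
    _ = ∫⁻ t, ∫⁻ x, ‖f x‖ₑ ^ (2 : ℝ) ∂μ ∂ν := by
        refine lintegral_congr fun t => ?_
        exact lintegral_sub_right_eq_self (fun x => ‖f x‖ₑ ^ (2 : ℝ)) t
    _ = ∫⁻ x, ‖f x‖ₑ ^ (2 : ℝ) ∂μ := by simp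

/-- Uniform continuity makes the error uniformly small, and for radii below 1 it lives on the fixed
compact set K, whose finite measure turns a uniform bound into an L² bound. -/
theorem tendsto_eLpNorm_normed_convolution_of_continuous {φ : ℕ → ContDiffBump (0 : E)}
    (hφ : Tendsto (fun k => (φ k).rOut) atTop (𝓝 0)) {g : E → ℂ} (hg : Continuous g)
    (hgc : HasCompactSupport g) :
    Tendsto (fun k => eLpNorm ((φ k).normed μ ⋆[lsmul ℝ ℝ, μ] g - g) 2 μ) atTop (𝓝 0) := by
  set K : Set E := Metric.cthickening 1 (tsupport g) with hK
  have hKc : IsCompact K := hgc.isCompact.cthickening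
  have hKm : μ K ≠ ⊤ := hKc.measure_lt_top.ne
  rw [ENNReal.tendsto_nhds_zero]
  intro ε hε
  obtain ⟨δ, hδ0, hδ⟩ : ∃ δ : ℝ, 0 < δ ∧ μ K ^ (1 / 2 : ℝ) * ENNReal.ofReal δ ≤ ε := by
    have hc : μ K ^ (1 / 2 : ℝ) ≠ ⊤ := ENNReal.rpow_ne_top_of_nonneg (by norm_num) hKm
    have ht : Tendsto (fun δ : ℝ => μ K ^ (1 / 2 : ℝ) * ENNReal.ofReal δ) (𝓝[>] 0) (𝓝 0) := by
      have h0 : Tendsto (fun δ : ℝ => ENNReal.ofReal δ) (𝓝[>] 0) (𝓝 0) := by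
        have := ENNReal.continuous_ofReal.tendsto 0
        rw [ENNReal.ofReal_zero] at this
        exact this.mono_left nhdsWithin_le_nhds
      simpa using ENNReal.Tendsto.const_mul h0 (Or.inr hc)
    obtain ⟨δ, h1, h2⟩ := ((ht.eventually_le_const hε).and self_mem_nhdsWithin).exists
    exact ⟨δ, h2, h1⟩
  obtain ⟨r, hr0, hr⟩ := Metric.uniformContinuous_iff.1
    (hgc.uniformContinuous_of_continuous hg) δ hδ0
  filter_upwards [hφ.eventually_lt_const hr0, hφ.eventually_lt_const one_pos] with k hk hk1
  have hdist : ∀ x, ‖((φ k).normed μ ⋆[lsmul ℝ ℝ, μ] g - g) x‖ ≤ δ := fun x => by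
    rw [Pi.sub_apply, ← dist_eq_norm]
    refine (φ k).dist_normed_convolution_le hg.aestronglyMeasurable fun y hy => ?_
    exact (hr ((Metric.mem_ball.1 hy).trans hk)).le
  have hsupp : ∀ x, x ∉ K → ((φ k).normed μ ⋆[lsmul ℝ ℝ, μ] g - g) x = 0 := fun x hx => by
    have hz : ∀ y ∈ Metric.ball x (φ k).rOut, g y = 0 := fun y hy => by
      by_contra hne
      exact hx (Metric.mem_cthickening_of_dist_le x y 1 _ (subset_tsupport _ hne)
        (by rw [dist_comm]; exact ((Metric.mem_ball.1 hy).trans hk1).le))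
    have hx0 := hz x (Metric.mem_ball_self (φ k).rOut_pos)
    rw [Pi.sub_apply, (φ k).normed_convolution_eq_right fun y hy => by rw [hz y hy, hx0], sub_self]
  have heq : eLpNorm ((φ k).normed μ ⋆[lsmul ℝ ℝ, μ] g - g) 2 μ =
      eLpNorm ((φ k).normed μ ⋆[lsmul ℝ ℝ, μ] g - g) 2 (μ.restrict K) := by
    rw [← eLpNorm_indicator_eq_eLpNorm_restrict hKc.isClosed.measurableSet]
    congr 1
    symm
    rw [indicator_eq_self]
    intro x hx
    by_contra h
    exact hx (hsupp x h)
  rw [heq]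
  refine le_trans (eLpNorm_le_of_ae_bound (C := δ) (Eventually.of_forall hdist)) ?_
  simpa using hδ

/-- Mollifications of a square integrable function converge to it in `L²`. -/
theorem tendsto_eLpNorm_normed_convolution {φ : ℕ → ContDiffBump (0 : E)}
    (hφ : Tendsto (fun k => (φ k).rOut) atTop (𝓝 0)) {f : E → ℂ} (hf : MemLp f 2 μ)
    (hfm : Measurable f) :
    Tendsto (fun k => eLpNorm ((φ k).normed μ ⋆[lsmul ℝ ℝ, μ] f - f) 2 μ) atTop (𝓝 0) := by
  rw [ENNReal.tendsto_nhds_zero]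
  intro ε hε
  have hε3 : ε / 3 ≠ 0 := (ENNReal.div_pos hε.ne' (by norm_num)).ne'
  obtain ⟨g, hgc, hfg, hg, hgL⟩ := hf.exists_hasCompactSupport_eLpNorm_sub_le (by norm_num) hε3
  have hlim := tendsto_eLpNorm_normed_convolution_of_continuous (μ := μ) hφ hg hgc
  filter_upwards [(ENNReal.tendsto_nhds_zero.1 hlim) (ε / 3) (pos_iff_ne_zero.2 hε3)] with k hk
  have hloc : ∀ {u : E → ℂ}, MemLp u 2 μ →
      ConvolutionExists ((φ k).normed μ) u (lsmul ℝ ℝ) μ := fun hu =>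
    (φ k).hasCompactSupport_normed.convolutionExists_left _ (φ k).continuous_normed
      (hu.locallyIntegrable (by norm_num))
  have hcont : ∀ {u : E → ℂ}, MemLp u 2 μ →
      Continuous ((φ k).normed μ ⋆[lsmul ℝ ℝ, μ] u) := fun hu =>
    (φ k).hasCompactSupport_normed.continuous_convolution_left _ (φ k).continuous_normed
      (hu.locallyIntegrable (by norm_num))
  -- Only the middle term needs k large. The two terms with f - g are at most ε/3 each, the first by
  -- the contraction property.
  have hsplit : (φ k).normed μ ⋆[lsmul ℝ ℝ, μ] f - f =
      ((φ k).normed μ ⋆[lsmul ℝ ℝ, μ] (f - g)) +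
        (((φ k).normed μ ⋆[lsmul ℝ ℝ, μ] g - g) - (f - g)) := by
    have h1 : f = (f - g) + g := by simp
    have h2 : (φ k).normed μ ⋆[lsmul ℝ ℝ, μ] f =
        ((φ k).normed μ ⋆[lsmul ℝ ℝ, μ] (f - g)) + ((φ k).normed μ ⋆[lsmul ℝ ℝ, μ] g) := by
      conv_lhs => rw [h1]
      exact (hloc (hf.sub hgL)).distrib_add (hloc hgL)
    rw [h2]; abel
  rw [hsplit]
  have m1 := (hcont (hf.sub hgL)).aestronglyMeasurable (μ := μ)
  have m2 := ((hcont hgL).sub hg).aestronglyMeasurable (μ := μ)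
  have m3 := hf.1.sub hgL.1
  calc _ ≤ _ := eLpNorm_add_le m1 (m2.sub m3) (by norm_num)
    _ ≤ ε / 3 + (ε / 3 + ε / 3) := by
      gcongr
      · exact (eLpNorm_normed_convolution_le _ (hfm.sub hg.measurable)).trans hfg
      · exact (eLpNorm_sub_le m2 m3 (by norm_num)).trans (add_le_add hk hfg)
    _ = ε := by rw [← add_assoc, ENNReal.add_thirds]

end Mollification

end PontryaginKoopman

end

noncomputable section

namespace PontryaginKoopman

open Filter Topology Set Convolution ContinuousLinearMap
open scoped ENNReal NNReal

/-! ### From smooth functions to W_{1,2}: bilinear identities by local approximation -/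

section LocalApproximation

variable {n : ℕ}

/-- The standard basis vectors of phase space. -/
def basisVec (i : Fin n ⊕ Fin n) : Phase n := EuclideanSpace.single i 1

/-- A function (index `none`) together with its partial derivatives. -/
def jet {𝕜 : Type*} [NormedAddCommGroup 𝕜] [NormedSpace ℝ 𝕜] (A : Phase n → 𝕜) :
    Option (Fin n ⊕ Fin n) → Phase n → 𝕜
  | none => A
  | some i => fun z => fderiv ℝ A z (basisVec i)

/-- An element of `W_{1,2}(D)` (index `none`) together with its weak partial derivatives. -/
def weakJet {D : Set (Phase n)} (φ : W12 D) : Option (Fin n ⊕ Fin n) → L2 D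
  | none => fnOf φ
  | some i => gradOf φ i

theorem continuous_jet {𝕜 : Type*} [NormedAddCommGroup 𝕜] [NormedSpace ℝ 𝕜] {A : Phase n → 𝕜}
    (hA : ContDiff ℝ ∞ A) (s : Option (Fin n ⊕ Fin n)) : Continuous (jet A s) := by
  cases s with
  | none => exact hA.continuous
  | some i => exact (hA.continuous_fderiv (by simp)).clm_apply continuous_const

/-- On points away from the boundary, mollification commutes with weak derivatives. -/
theorem fderiv_normed_convolution_eq {D : Set (Phase n)} (hD : IsOpen D) (φ : W12 D)
    (ρ : ContDiffBump (0 : Phase n)) {z : Phase n} (hz : Metric.closedBall z ρ.rOut ⊆ D)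
    (i : Fin n ⊕ Fin n) :
    fderiv ℝ (ρ.normed volume ⋆[lsmul ℝ ℝ, volume] (D.indicator (fnOf φ))) z (basisVec i) =
      (ρ.normed volume ⋆[lsmul ℝ ℝ, volume] (D.indicator (gradOf φ i))) z := by
  have hloc : LocallyIntegrable (D.indicator (fnOf φ : Phase n → ℂ)) volume :=
    ((memLp_indicator_iff_restrict hD.measurableSet).2 (Lp.memLp (fnOf φ))).locallyIntegrable
      (by norm_num)
  have hρc : HasCompactSupport (ρ.normed (volume : Measure (Phase n))) :=
    ρ.hasCompactSupport_normed
  have hρs : ContDiff ℝ ∞ (ρ.normed (volume : Measure (Phase n))) := ρ.contDiff_normed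
  have hder := hρc.hasFDerivAt_convolution_left (lsmul ℝ ℝ) (hρs.of_le (by simp)) hloc z
  have hint : ConvolutionExistsAt (fderiv ℝ (ρ.normed (volume : Measure (Phase n))))
      (D.indicator (fnOf φ : Phase n → ℂ)) z ((lsmul ℝ ℝ).precompL (Phase n)) volume :=
    (hρc.fderiv ℝ).convolutionExists_left _ (hρs.continuous_fderiv (by simp)) hloc z
  rw [hder.fderiv, convolution_eq_swap, ContinuousLinearMap.integral_apply hint.integrable_swap,
    convolution_eq_swap]
  -- The reflected kernel centred at z is an admissible test function because its support lies in
  -- the closed ball inside D. The sign from the reflection cancels the one in the definition of the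
  -- weak derivative.
  set χ : Phase n → ℝ := fun t => ρ.normed volume (z - t) with hχ
  have hχs : ContDiff ℝ ∞ χ := hρs.comp (contDiff_const.sub contDiff_id)
  have hsupp : tsupport χ ⊆ Metric.closedBall z ρ.rOut := by
    refine closure_minimal (fun t ht => ?_) Metric.isClosed_closedBall
    have : z - t ∈ Function.support (ρ.normed (volume : Measure (Phase n))) := ht
    rw [ρ.support_normed_eq, mem_ball_zero_iff] at this
    rw [mem_closedBall_iff_norm']
    exact this.le
  have hχc : HasCompactSupport χ :=
    (isCompact_closedBall z ρ.rOut).of_isClosed_subset (isClosed_tsupport χ) hsupp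
  have hweak := φ.2 i χ hχs hχc (hsupp.trans hz)
  have hdχ : ∀ t, fderiv ℝ χ t (basisVec i) =
      -fderiv ℝ (ρ.normed (volume : Measure (Phase n))) (z - t) (basisVec i) := fun t => by
    have h1 : HasFDerivAt (fun t : Phase n => z - t) (-ContinuousLinearMap.id ℝ (Phase n)) t := by
      simpa using! (hasFDerivAt_id t).const_sub z
    have h2 := ((hρs.differentiable (by simp)) (z - t)).hasFDerivAt.comp t h1
    rw [hχ]
    erw [h2.fderiv]
    simp
  have hind : ∀ (w : Phase n → ℝ) (u : Phase n → ℂ),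
      ∫ t, w t • D.indicator u t = ∫ t in D, w t • u t := fun w u => by
    rw [← integral_indicator hD.measurableSet]
    refine integral_congr_ae (Eventually.of_forall fun t => ?_)
    by_cases ht : t ∈ D <;> simp [ht]
  simp only [precompL_apply, lsmul_apply]
  rw [hind (fun t => fderiv ℝ (ρ.normed (volume : Measure (Phase n))) (z - t) (basisVec i)),
    hind (fun t => ρ.normed (volume : Measure (Phase n)) (z - t))]
  have hneg : ∫ t in D, fderiv ℝ (ρ.normed (volume : Measure (Phase n))) (z - t) (basisVec i) •
      fnOf φ t = -∫ t in D, fderiv ℝ χ t (EuclideanSpace.single i 1) • fnOf φ t := by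
    rw [← integral_neg]
    refine integral_congr_ae (Eventually.of_forall fun t => ?_)
    have := hdχ t
    simp only [basisVec] at this ⊢
    rw [this, neg_smul, neg_neg]
  rw [hneg]
  change -(∫ t in D, fderiv ℝ χ t (EuclideanSpace.single i 1) • φ.1.1 t) = _
  rw [hweak, neg_neg]
  rfl

/-- Elements of `W_{1,2}(D)` can be approximated by smooth functions on compact subsets of `D`. -/
theorem exists_smooth_approx {D K : Set (Phase n)} (hD : IsOpen D) (hK : IsCompact K)
    (hKD : K ⊆ D) (φ : W12 D) :
    ∃ A : ℕ → Phase n → ℂ, (∀ k, ContDiff ℝ ∞ (A k)) ∧ ∀ s,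
      Tendsto (fun k => eLpNorm (jet (A k) s - (weakJet φ s : Phase n → ℂ)) 2 (volume.restrict K)) atTop (𝓝 0) := by
  set ρ : ℕ → ContDiffBump (0 : Phase n) := fun k =>
    ⟨1 / (k + 1) / 2, 1 / (k + 1), by positivity, half_lt_self (by positivity)⟩ with hρ
  have hlim : Tendsto (fun k => (ρ k).rOut) atTop (𝓝 0) := tendsto_one_div_add_atTop_nhds_zero_nat
  have hL : ∀ s, MemLp (D.indicator (weakJet φ s : Phase n → ℂ)) 2 volume := fun s =>
    (memLp_indicator_iff_restrict hD.measurableSet).2 (Lp.memLp (weakJet φ s))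
  have hm : ∀ s, Measurable (D.indicator (weakJet φ s : Phase n → ℂ)) := fun s =>
    (Lp.stronglyMeasurable (weakJet φ s)).measurable.indicator hD.measurableSet
  refine ⟨fun k => (ρ k).normed volume ⋆[lsmul ℝ ℝ, volume] (D.indicator (fnOf φ)), fun k => ?_,
    fun s => ?_⟩
  · exact (ρ k).hasCompactSupport_normed.contDiff_convolution_left _ (ρ k).contDiff_normed
      ((hL none).locallyIntegrable (by norm_num))
  · have hmain := tendsto_eLpNorm_normed_convolution (μ := (volume : Measure (Phase n))) hlim
      (hL s) (hm s)
    -- Once the radius is below δ, every ball around a point of K stays in D, and there the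
    -- classical jet of the mollification is the mollified weak jet.
    obtain ⟨δ, hδ0, hδ⟩ := hK.exists_cthickening_subset_open hD hKD
    refine tendsto_of_tendsto_of_tendsto_of_le_of_le' tendsto_const_nhds hmain
      (Eventually.of_forall fun _ => zero_le) ?_
    filter_upwards [hlim.eventually_lt_const hδ0] with k hk
    refine le_trans (le_of_eq ?_) (eLpNorm_mono_measure _ (Measure.restrict_le_self (s := K)))
    refine eLpNorm_congr_ae ?_
    filter_upwards [ae_restrict_mem hK.isClosed.measurableSet] with z hz
    have hball : Metric.closedBall z (ρ k).rOut ⊆ D := fun y hy =>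
      hδ (Metric.mem_cthickening_of_dist_le y z δ K hz ((Metric.mem_closedBall.1 hy).trans hk.le))
    simp only [Pi.sub_apply, indicator_of_mem (hKD hz)]
    cases s with
    | none => rfl
    | some i => exact congrArg (· - _) (fderiv_normed_convolution_eq hD φ (ρ k) hball i)

theorem tendsto_integral_mul_of_tendsto_eLpNorm {α : Type*} [MeasurableSpace α] {ν : Measure α}
    {a : ℕ → α → ℂ} {a₀ b : α → ℂ} (ha : ∀ k, MemLp (a k) 2 ν) (ha₀ : MemLp a₀ 2 ν)
    (hb : MemLp b 2 ν) (h : Tendsto (fun k => eLpNorm (a k - a₀) 2 ν) atTop (𝓝 0)) :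
    Tendsto (fun k => ∫ x, a k x * b x ∂ν) atTop (𝓝 (∫ x, a₀ x * b x ∂ν)) := by
  refine tendsto_integral_of_L1' _ (ha₀.1.mul hb.1)
    (Eventually.of_forall fun k => memLp_one_iff_integrable.1 (hb.mul' (ha k))) ?_
  have hlim : Tendsto (fun k => eLpNorm (a k - a₀) 2 ν * eLpNorm b 2 ν) atTop (𝓝 0) := by
    simpa using ENNReal.Tendsto.mul_const h (Or.inr hb.eLpNorm_ne_top)
  refine tendsto_of_tendsto_of_tendsto_of_le_of_le tendsto_const_nhds hlim
    (fun _ => zero_le) fun k => ?_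
  have heq : ((fun x => a k x * b x) - fun x => a₀ x * b x) = (a k - a₀) • b := by
    ext x; simp [sub_mul]
  refine (congrArg (fun g => eLpNorm g 1 ν) heq).le.trans ?_
  exact eLpNorm_smul_le_mul_eLpNorm hb.1 ((ha k).1.sub ha₀.1)

variable {K : Set (Phase n)}

theorem memLp_two_of_continuous {𝕜 : Type*} [NormedAddCommGroup 𝕜] (hK : IsCompact K)
    {g : Phase n → 𝕜} (hg : Continuous g) [SecondCountableTopologyEither (Phase n) 𝕜] :
    MemLp g 2 (volume.restrict K) := by
  obtain ⟨C, hC⟩ := hK.exists_bound_of_continuousOn hg.continuousOn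
  have : IsFiniteMeasure (volume.restrict K) := ⟨by simpa using hK.measure_lt_top⟩
  exact MemLp.of_bound hg.aestronglyMeasurable C
    ((ae_restrict_mem hK.isClosed.measurableSet).mono hC)

theorem integrable_coef_mul {c : Phase n → ℝ} (hc : MemLp c ⊤ (volume.restrict K))
    {a b : Phase n → ℂ} (ha : MemLp a 2 (volume.restrict K)) (hb : MemLp b 2 (volume.restrict K)) :
    Integrable (fun z => a z * ((c z : ℂ) * b z)) (volume.restrict K) :=
  memLp_one_iff_integrable.1
    ((MemLp.mul' (p := ⊤) (q := 2) (r := 2) hb (hc.ofReal (K := ℂ))).mul' ha)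

/-- Bounded coefficients keep `c s t * b t` in L², so each summand converges by Hölder. -/
theorem tendsto_integral_bilinear {ι : Type*} [Fintype ι]
    {c : ι → ι → Phase n → ℝ} (hc : ∀ s t, MemLp (c s t) ⊤ (volume.restrict K))
    {a : ℕ → ι → Phase n → ℂ} {a₀ b : ι → Phase n → ℂ}
    (ha : ∀ k s, MemLp (a k s) 2 (volume.restrict K))
    (ha₀ : ∀ s, MemLp (a₀ s) 2 (volume.restrict K))
    (hb : ∀ s, MemLp (b s) 2 (volume.restrict K))
    (h : ∀ s, Tendsto (fun k => eLpNorm (a k s - a₀ s) 2 (volume.restrict K)) atTop (𝓝 0)) :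
    Tendsto (fun k => ∫ z in K, ∑ s, ∑ t, a k s z * ((c s t z : ℂ) * b t z)) atTop
      (𝓝 (∫ z in K, ∑ s, ∑ t, a₀ s z * ((c s t z : ℂ) * b t z))) := by
  have hsplit : ∀ u : ι → Phase n → ℂ, (∀ s, MemLp (u s) 2 (volume.restrict K)) →
      ∫ z in K, ∑ s, ∑ t, u s z * ((c s t z : ℂ) * b t z) =
        ∑ s, ∑ t, ∫ z in K, u s z * ((c s t z : ℂ) * b t z) := fun u hu => by
    rw [integral_finsetSum _ fun s _ => integrable_finsetSum _ fun t _ =>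
      integrable_coef_mul (hc s t) (hu s) (hb t)]
    exact Finset.sum_congr rfl fun s _ =>
      integral_finsetSum _ fun t _ => integrable_coef_mul (hc s t) (hu s) (hb t)
  rw [hsplit a₀ ha₀]
  simp only [fun k => hsplit (a k) (ha k)]
  refine tendsto_finsetSum _ fun s _ => tendsto_finsetSum _ fun t _ => ?_
  exact tendsto_integral_mul_of_tendsto_eLpNorm (fun k => ha k s) (ha₀ s)
    (MemLp.mul' (p := ⊤) (q := 2) (r := 2) (hb t) ((hc s t).ofReal (K := ℂ))) (h s)

/-- A bilinear integral identity for the jets of real smooth functions holds for complex smooth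
functions. -/
theorem integral_jet_bilinear_complex (hK : IsCompact K)
    {c : Option (Fin n ⊕ Fin n) → Option (Fin n ⊕ Fin n) → Phase n → ℝ}
    (hc : ∀ s t, MemLp (c s t) ⊤ (volume.restrict K))
    (h : ∀ A B : Phase n → ℝ, ContDiff ℝ ∞ A → ContDiff ℝ ∞ B →
      ∫ z in K, ∑ s, ∑ t, jet A s z * (c s t z * jet B t z) = 0)
    {A B : Phase n → ℂ} (hA : ContDiff ℝ ∞ A) (hB : ContDiff ℝ ∞ B) :
    ∫ z in K, ∑ s, ∑ t, jet A s z * ((c s t z : ℂ) * jet B t z) = 0 := by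
  have hre : ∀ {A : Phase n → ℂ}, ContDiff ℝ ∞ A → ContDiff ℝ ∞ fun z => (A z).re :=
    fun hA => Complex.reCLM.contDiff.comp hA
  have him : ∀ {A : Phase n → ℂ}, ContDiff ℝ ∞ A → ContDiff ℝ ∞ fun z => (A z).im :=
    fun hA => Complex.imCLM.contDiff.comp hA
  have hjet : ∀ {A : Phase n → ℂ}, ContDiff ℝ ∞ A → ∀ s z, jet A s z =
      ((jet (fun z => (A z).re) s z : ℝ) : ℂ) + ((jet (fun z => (A z).im) s z : ℝ) : ℂ) * Complex.I := by
    intro A hA s z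
    cases s with
    | none => exact (Complex.re_add_im (A z)).symm
    | some i =>
      have hd : HasFDerivAt A (fderiv ℝ A z) z := (hA.differentiable (by simp) z).hasFDerivAt
      have h1 : fderiv ℝ (fun z => (A z).re) z = Complex.reCLM ∘L fderiv ℝ A z :=
        (Complex.reCLM.hasFDerivAt.comp z hd).fderiv
      have h2 : fderiv ℝ (fun z => (A z).im) z = Complex.imCLM ∘L fderiv ℝ A z :=
        (Complex.imCLM.hasFDerivAt.comp z hd).fderiv
      simp only [jet, h1, h2]
      exact (Complex.re_add_im _).symm
  -- The form is bilinear with real coefficients, so splitting A and B into real and imaginary parts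
  -- leaves four instances of the real identity.
  set T : (Phase n → ℝ) → (Phase n → ℝ) → Phase n → ℂ := fun A B z =>
    ∑ s, ∑ t, ((jet A s z : ℝ) : ℂ) * ((c s t z : ℂ) * ((jet B t z : ℝ) : ℂ)) with hT
  have hTreal : ∀ A B z, T A B z =
      ((∑ s, ∑ t, jet A s z * (c s t z * jet B t z) : ℝ) : ℂ) := fun A B z => by
    simp [hT]
  have hTint : ∀ A B : Phase n → ℝ, ContDiff ℝ ∞ A → ContDiff ℝ ∞ B →
      Integrable (T A B) (volume.restrict K) := fun A B hA hB =>
    integrable_finsetSum _ fun s _ => integrable_finsetSum _ fun t _ =>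
      integrable_coef_mul (hc s t)
        (memLp_two_of_continuous hK (Complex.continuous_ofReal.comp (continuous_jet hA s)))
        (memLp_two_of_continuous hK (Complex.continuous_ofReal.comp (continuous_jet hB t)))
  have hT0 : ∀ A B : Phase n → ℝ, ContDiff ℝ ∞ A → ContDiff ℝ ∞ B →
      ∫ z in K, T A B z = 0 := fun A B hA hB => by
    simp only [hTreal]
    rw [integral_complex_ofReal, h A B hA hB, Complex.ofReal_zero]
  have hsum : ∀ z, ∑ s, ∑ t, jet A s z * ((c s t z : ℂ) * jet B t z) =
      (T (fun z => (A z).re) (fun z => (B z).re) z - T (fun z => (A z).im) (fun z => (B z).im) z) +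
      (T (fun z => (A z).re) (fun z => (B z).im) z + T (fun z => (A z).im) (fun z => (B z).re) z) *
        Complex.I := fun z => by
    simp only [hT, ← Finset.sum_sub_distrib, ← Finset.sum_add_distrib, Finset.sum_mul]
    refine Finset.sum_congr rfl fun s _ => Finset.sum_congr rfl fun t _ => ?_
    rw [hjet hA, hjet hB]
    linear_combination ((jet (fun z => (A z).im) s z : ℝ) : ℂ) * (c s t z : ℂ) *
      ((jet (fun z => (B z).im) t z : ℝ) : ℂ) * Complex.I_mul_I
  simp only [hsum]
  have i1 := hTint _ _ (hre hA) (hre hB)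
  have i2 := hTint _ _ (him hA) (him hB)
  have i3 := hTint _ _ (hre hA) (him hB)
  have i4 := hTint _ _ (him hA) (hre hB)
  have j1 : Integrable (fun z => T (fun z => (A z).re) (fun z => (B z).re) z -
      T (fun z => (A z).im) (fun z => (B z).im) z) (volume.restrict K) := i1.sub i2
  have j2 : Integrable (fun z => T (fun z => (A z).re) (fun z => (B z).im) z +
      T (fun z => (A z).im) (fun z => (B z).re) z) (volume.restrict K) := i3.add i4
  rw [integral_add j1 (j2.mul_const _), integral_sub i1 i2,
    integral_mul_const, integral_add i3 i4, hT0 _ _ (hre hA) (hre hB), hT0 _ _ (him hA) (him hB),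
    hT0 _ _ (hre hA) (him hB), hT0 _ _ (him hA) (hre hB)]
  simp

/-- A bilinear integral identity with bounded coefficients which holds for the jets of real smooth
functions holds for the weak jets of elements of `W_{1,2}(D)`. -/
theorem integral_weakJet_bilinear {D : Set (Phase n)} (hD : IsOpen D) (hK : IsCompact K)
    (hKD : K ⊆ D) {c : Option (Fin n ⊕ Fin n) → Option (Fin n ⊕ Fin n) → Phase n → ℝ}
    (hc : ∀ s t, MemLp (c s t) ⊤ (volume.restrict K))
    (h : ∀ A B : Phase n → ℝ, ContDiff ℝ ∞ A → ContDiff ℝ ∞ B →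
      ∫ z in K, ∑ s, ∑ t, jet A s z * (c s t z * jet B t z) = 0)
    (φ ψ : W12 D) :
    ∫ z in K, ∑ s, ∑ t, weakJet φ s z * ((c s t z : ℂ) * weakJet ψ t z) = 0 := by
  have hw : ∀ (φ : W12 D) s, MemLp (weakJet φ s : Phase n → ℂ) 2 (volume.restrict K) := fun φ s =>
    (Lp.memLp (weakJet φ s)).mono_measure (Measure.restrict_mono_set _ hKD)
  have hs : ∀ {A : Phase n → ℂ}, ContDiff ℝ ∞ A → ∀ s, MemLp (jet A s) 2 (volume.restrict K) :=
    fun hA s => memLp_two_of_continuous hK (continuous_jet hA s)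
  obtain ⟨A, hA, hAlim⟩ := exists_smooth_approx hD hK hKD φ
  obtain ⟨B, hB, hBlim⟩ := exists_smooth_approx hD hK hKD ψ
  have h1 : ∀ B : Phase n → ℂ, ContDiff ℝ ∞ B →
      ∫ z in K, ∑ s, ∑ t, weakJet φ s z * ((c s t z : ℂ) * jet B t z) = 0 := fun B hB => by
    have ht := tendsto_integral_bilinear hc (fun k => hs (hA k)) (hw φ) (hs hB) hAlim
    simp only [fun k => integral_jet_bilinear_complex hK hc h (hA k) hB] at ht
    exact (tendsto_nhds_unique tendsto_const_nhds ht).symm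
  -- The limits are taken one slot at a time. Transposing the coefficients lets the same convergence
  -- lemma serve the second slot.
  have hflip : ∀ (a b : Option (Fin n ⊕ Fin n) → Phase n → ℂ),
      ∫ z in K, ∑ s, ∑ t, a s z * ((c s t z : ℂ) * b t z) =
        ∫ z in K, ∑ t, ∑ s, b t z * ((c s t z : ℂ) * a s z) := fun a b => by
    refine integral_congr_ae (Eventually.of_forall fun z => ?_)
    simp only
    rw [Finset.sum_comm]
    exact Finset.sum_congr rfl fun t _ => Finset.sum_congr rfl fun s _ => by ring
  have ht := tendsto_integral_bilinear (c := fun t s => c s t) (fun t s => hc s t)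
    (fun k => hs (hB k)) (hw ψ) (hw φ) hBlim
  rw [← hflip] at ht
  simp only [← hflip, fun k => h1 (B k) (hB k)] at ht
  exact (tendsto_nhds_unique tendsto_const_nhds ht).symm

end LocalApproximation

end PontryaginKoopman

end

noncomputable section

namespace PontryaginKoopman

open Filter Topology Set Convolution ContinuousLinearMap
open scoped NNReal

/-! ### Poisson brackets of smooth functions and integration by parts -/

section Poisson

variable {n : ℕ}

/-- A smooth cutoff function for a compact set inside an open set. -/
theorem exists_smooth_cutoff {D K : Set (Phase n)} (hD : IsOpen D) (hK : IsCompact K)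
    (hKD : K ⊆ D) :
    ∃ η : Phase n → ℝ, ContDiff ℝ ∞ η ∧ HasCompactSupport η ∧ tsupport η ⊆ D ∧
      (∀ᶠ z in 𝓝ˢ K, η z = 1) ∧ ∀ z, η z ∈ Icc (0 : ℝ) 1 := by
  obtain ⟨L, hL, hKL, hLD⟩ := exists_compact_between hK hD hKD
  obtain ⟨η, h1, h0, h01⟩ := exists_contMDiffMap_one_nhds_of_subset_interior
    (n := (⊤ : ℕ∞)) (modelWithCornersSelf ℝ (Phase n)) hK.isClosed hKL
  have hsupp : tsupport η ⊆ L :=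
    closure_minimal (fun z hz => by_contra fun hzL => hz (h0 z hzL)) hL.isClosed
  exact ⟨η, η.contMDiff.contDiff, hL.of_isClosed_subset (isClosed_tsupport _) hsupp,
    hsupp.trans hLD, h1, h01⟩

/-- The sign of a coordinate: positive for the state, negative for the co-state. -/
def coordSign : Fin n ⊕ Fin n → ℝ := Sum.elim (fun _ => 1) (fun _ => -1)

theorem coordSign_swap (i : Fin n ⊕ Fin n) : coordSign i.swap = -coordSign i := by
  cases i <;> simp [coordSign]

theorem sum_swap {M : Type*} [AddCommMonoid M] (g : Fin n ⊕ Fin n → M) :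
    ∑ i : Fin n ⊕ Fin n, g i.swap = ∑ i, g i :=
  Equiv.sum_comp (Equiv.sumComm (Fin n) (Fin n)) g

theorem Omega_eq (i j : Fin n ⊕ Fin n) :
    Omega n i j = if j = i.swap then (coordSign i : ℂ) else 0 := by
  rcases i with i | i <;> rcases j with j | j <;>
    simp [Omega, coordSign, Matrix.one_apply, eq_comm (a := j)]
  split_ifs <;> simp

/-- The partial derivatives of a function. -/
def partialD (b : Phase n → ℝ) (i : Fin n ⊕ Fin n) (z : Phase n) : ℝ := fderiv ℝ b z (basisVec i)

/-- The Hamiltonian vector field `Ω ∇b`. -/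
def hamVec (b : Phase n → ℝ) (z : Phase n) : Phase n :=
  ∑ i, (coordSign i * partialD b i.swap z) • basisVec i

/-- The Poisson bracket `{a, b} = ∇aᵀ Ω ∇b`. -/
def poisson (a b : Phase n → ℝ) (z : Phase n) : ℝ :=
  ∑ i, coordSign i * partialD a i z * partialD b i.swap z

theorem poisson_eq (a b : Phase n → ℝ) (z : Phase n) : poisson a b z = fderiv ℝ a z (hamVec b z) := by
  simp only [poisson, hamVec, map_sum, map_smul, smul_eq_mul, partialD]
  exact Finset.sum_congr rfl fun i _ => by ring

theorem poisson_eq_neg_sum (a b : Phase n → ℝ) (z : Phase n) :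
    poisson a b z = -∑ i, coordSign i * partialD a i.swap z * partialD b i z := by
  rw [poisson, ← sum_swap, ← Finset.sum_neg_distrib]
  exact Finset.sum_congr rfl fun i _ => by rw [coordSign_swap, Sum.swap_swap]; ring

theorem hasFDerivAt_partialD {b : Phase n → ℝ} {z : Phase n} (hb : ContDiffAt ℝ 2 b z)
    (i : Fin n ⊕ Fin n) :
    HasFDerivAt (partialD b i) ((ContinuousLinearMap.apply ℝ ℝ (basisVec i)) ∘L
      fderiv ℝ (fderiv ℝ b) z) z := by
  have h : DifferentiableAt ℝ (fderiv ℝ b) z :=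
    (hb.fderiv_right (m := 1) (by norm_num)).differentiableAt (by simp)
  exact (ContinuousLinearMap.apply ℝ ℝ (basisVec i)).hasFDerivAt.comp z h.hasFDerivAt

theorem contDiffAt_partialD {b : Phase n → ℝ} {z : Phase n} (hb : ContDiffAt ℝ 2 b z)
    (i : Fin n ⊕ Fin n) : ContDiffAt ℝ 1 (partialD b i) z :=
  (hb.fderiv_right (m := 1) (by norm_num)).clm_apply contDiffAt_const

theorem contDiffAt_poisson {a b : Phase n → ℝ} {z : Phase n} (ha : ContDiffAt ℝ 2 a z)
    (hb : ContDiffAt ℝ 2 b z) : ContDiffAt ℝ 1 (poisson a b) z :=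
  ContDiffAt.sum fun i _ =>
    (contDiffAt_const.mul (contDiffAt_partialD ha i)).mul (contDiffAt_partialD hb i.swap)

/-- Product rule; reindexing the second half by the swap of state and co-state flips its sign. In
this form the Jacobi identity becomes a cancellation of Hessians. -/
theorem fderiv_poisson {a b : Phase n → ℝ} {z : Phase n} (ha : ContDiffAt ℝ 2 a z)
    (hb : ContDiffAt ℝ 2 b z) (v : Phase n) :
    fderiv ℝ (poisson a b) z v = fderiv ℝ (fderiv ℝ a) z v (hamVec b z) -
      fderiv ℝ (fderiv ℝ b) z v (hamVec a z) := by
  have h : HasFDerivAt (poisson a b) _ z := HasFDerivAt.fun_sum fun i (_ : i ∈ Finset.univ) =>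
    ((hasFDerivAt_partialD ha i).const_mul (coordSign i)).mul (hasFDerivAt_partialD hb i.swap)
  have h2 : fderiv ℝ (fderiv ℝ b) z v (hamVec a z) =
      -∑ i, coordSign i * partialD a i z * fderiv ℝ (fderiv ℝ b) z v (basisVec i.swap) := by
    rw [← sum_swap, ← Finset.sum_neg_distrib]
    simp only [hamVec, map_sum, map_smul, smul_eq_mul]
    exact Finset.sum_congr rfl fun i _ => by rw [coordSign_swap, Sum.swap_swap]; ring
  rw [h.fderiv, h2, sub_neg_eq_add]
  simp only [hamVec, map_sum, map_smul, smul_eq_mul, sum_apply, ← Finset.sum_add_distrib]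
  refine Finset.sum_congr rfl fun i _ => ?_
  simp
  ring

/-- The Jacobi identity for the Poisson bracket. -/
theorem poisson_jacobi {a b h : Phase n → ℝ} {z : Phase n} (ha : ContDiffAt ℝ 2 a z)
    (hb : ContDiffAt ℝ 2 b z) (hh : ContDiffAt ℝ 2 h z) :
    poisson (poisson a b) h z - poisson (poisson a h) b z + poisson (poisson b h) a z = 0 := by
  have hsymm : ∀ {a : Phase n → ℝ}, ContDiffAt ℝ 2 a z → ∀ v w,
      fderiv ℝ (fderiv ℝ a) z v w = fderiv ℝ (fderiv ℝ a) z w v := fun ha v w =>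
    (ha.isSymmSndFDerivAt (by simp)) v w
  -- Each of the three Hessians occurs twice with opposite signs and exchanged arguments, so
  -- symmetry cancels the six terms in pairs.
  rw [poisson_eq _ h, poisson_eq _ b, poisson_eq _ a, fderiv_poisson ha hb, fderiv_poisson ha hh,
    fderiv_poisson hb hh, hsymm ha (hamVec h z), hsymm hb (hamVec h z), hsymm hh (hamVec b z)]
  ring

variable {D : Set (Phase n)} {χ : Phase n → ℝ} {C : ℝ≥0}

theorem partialD_eq_zero_of_notMem {z : Phase n} (hz : z ∉ tsupport χ) (i : Fin n ⊕ Fin n) :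
    partialD χ i z = 0 := by
  rw [partialD, fderiv_of_notMem_tsupport ℝ hz]
  rfl

theorem abs_partialD_le (hχ : LipschitzWith C χ) (i : Fin n ⊕ Fin n) (z : Phase n) :
    ‖partialD χ i z‖ ≤ C := by
  refine (le_opNorm _ _).trans ?_
  have h1 : ‖basisVec i‖ = 1 := by simp [basisVec]
  rw [h1, mul_one]
  exact norm_fderiv_le_of_lipschitz ℝ hχ

theorem measurable_partialD (i : Fin n ⊕ Fin n) : Measurable (partialD χ i) :=
  measurable_fderiv_apply_const ℝ χ (basisVec i)

theorem integrable_mul_of_continuousOn {K : Set (Phase n)} (hK : IsCompact K) {g w : Phase n → ℝ}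
    (hg : Measurable g) (hgb : ∃ C, ∀ z, ‖g z‖ ≤ C) (hgK : ∀ z, z ∉ K → g z = 0)
    (hw : ContinuousOn w K) : Integrable (fun z => w z * g z) := by
  obtain ⟨C, hC⟩ := hgb
  have h1 : IntegrableOn (fun z => w z * g z) K :=
    (hw.integrableOn_compact hK).mul_bdd hg.aestronglyMeasurable (Eventually.of_forall hC)
  refine (integrableOn_iff_integrable_of_support_subset fun z hz => ?_).1 h1
  by_contra hzK
  exact hz (by simp [hgK z hzK])

/-- Integration by parts against a compactly supported Lipschitz function. -/
theorem integral_mul_partialD (hD : IsOpen D) (hχ : LipschitzWith C χ) (hc : HasCompactSupport χ)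
    (hχD : tsupport χ ⊆ D) {w : Phase n → ℝ} (hw : ∀ z ∈ D, ContDiffAt ℝ 1 w z)
    (i : Fin n ⊕ Fin n) :
    ∫ z, w z * partialD χ i z = -∫ z, partialD w i z * χ z := by
  -- Since w is regular only on D, it is replaced by η w, which is globally C¹ with compact support
  -- and agrees with w near the support of χ. Integration by parts for Lipschitz functions then
  -- applies; χ is differentiable almost everywhere.
  obtain ⟨η, hη, hηc, hηD, hη1, -⟩ := exists_smooth_cutoff hD hc.isCompact hχD
  have hs : ContDiff ℝ 1 fun z => η z * w z := by
    rw [contDiff_iff_contDiffAt]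
    intro z
    by_cases hz : z ∈ tsupport η
    · exact (hη.of_le (by simp)).contDiffAt.mul (hw z (hηD hz))
    · have h0 : (fun z => η z * w z) =ᶠ[𝓝 z] fun _ => 0 := by
        filter_upwards [notMem_tsupport_iff_eventuallyEq.1 hz] with y hy
        simp [hy]
      exact contDiffAt_const.congr_of_eventuallyEq h0
  obtain ⟨M, hM⟩ := hs.lipschitzWith_of_hasCompactSupport hηc.mul_right (by simp)
  have key := hM.integral_lineDeriv_mul_eq (μ := volume) hχ hc (basisVec i)
  have hnear : ∀ z ∈ tsupport χ, (fun z => η z * w z) =ᶠ[𝓝 z] w := fun z hz => by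
    filter_upwards [eventually_nhdsSet_iff_forall.1 hη1 z hz] with y hy
    rw [hy, one_mul]
  have e1 : ∫ z, lineDeriv ℝ (fun z => η z * w z) z (basisVec i) * χ z =
      ∫ z, partialD w i z * χ z := by
    refine integral_congr_ae (Eventually.of_forall fun z => ?_)
    by_cases hz : z ∈ tsupport χ
    · simp only [(hs.differentiable (by simp) z).lineDeriv_eq_fderiv, (hnear z hz).fderiv_eq,
        partialD]
    · simp [image_eq_zero_of_notMem_tsupport hz]
  have e2 : ∫ z, lineDeriv ℝ χ z (-basisVec i) * (η z * w z) = -∫ z, w z * partialD χ i z := by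
    rw [← integral_neg]
    refine integral_congr_ae ?_
    filter_upwards [hχ.ae_differentiableAt (μ := volume)] with z hz
    simp only [hz.lineDeriv_eq_fderiv, map_neg]
    by_cases hzs : z ∈ tsupport χ
    · have h1 : η z * w z = w z := (hnear z hzs).eq_of_nhds
      rw [h1, partialD]; ring
    · have h0 := partialD_eq_zero_of_notMem hzs i
      simp only [partialD] at h0 ⊢
      simp [h0]
  have key' := e1.symm.trans (key.trans e2)
  linarith

/-- The divergence of `hamVec b`: swapping state and co-state changes the sign but not the mixed
second derivative, so the sum equals its negative. -/
theorem sum_coordSign_second_deriv {b : Phase n → ℝ} {z : Phase n} (hb : ContDiffAt ℝ 2 b z) :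
    ∑ i, coordSign i * partialD (partialD b i.swap) i z = 0 := by
  have h : ∀ i : Fin n ⊕ Fin n, partialD (partialD b i.swap) i z =
      fderiv ℝ (fderiv ℝ b) z (basisVec i) (basisVec i.swap) := fun i => by
    rw [partialD, (hasFDerivAt_partialD hb i.swap).fderiv]; rfl
  simp only [h]
  have h2 : ∑ i : Fin n ⊕ Fin n,
      coordSign i * fderiv ℝ (fderiv ℝ b) z (basisVec i) (basisVec i.swap) =
      -∑ i, coordSign i * fderiv ℝ (fderiv ℝ b) z (basisVec i) (basisVec i.swap) := by
    conv_lhs => rw [← sum_swap]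
    rw [← Finset.sum_neg_distrib]
    refine Finset.sum_congr rfl fun i _ => ?_
    rw [coordSign_swap, Sum.swap_swap, (hb.isSymmSndFDerivAt (by simp)) (basisVec i.swap)]
    ring
  linarith

theorem exists_bound_of_lipschitz_compact (hχ : LipschitzWith C χ) (hc : HasCompactSupport χ) :
    ∃ M, ∀ z, ‖χ z‖ ≤ M := hc.exists_bound_of_continuous hχ.continuous

/-- Hamiltonian vector fields are divergence free: integration by parts for Poisson brackets. -/
theorem integral_mul_poisson (hD : IsOpen D) (hχ : LipschitzWith C χ) (hc : HasCompactSupport χ)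
    (hχD : tsupport χ ⊆ D) {a b : Phase n → ℝ} (ha : ∀ z ∈ D, ContDiffAt ℝ 1 a z)
    (hb : ∀ z ∈ D, ContDiffAt ℝ 2 b z) :
    Integrable (fun z => a z * poisson χ b z) ∧ Integrable (fun z => poisson a b z * χ z) ∧
    ∫ z, a z * poisson χ b z = -∫ z, poisson a b z * χ z := by
  have hw : ∀ i : Fin n ⊕ Fin n, ∀ z ∈ D,
      ContDiffAt ℝ 1 (fun z => coordSign i * (a z * partialD b i.swap z)) z := fun i z hz =>
    contDiffAt_const.mul ((ha z hz).mul (contDiffAt_partialD (hb z hz) i.swap))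
  have e1 : ∀ z, a z * poisson χ b z =
      ∑ i, coordSign i * (a z * partialD b i.swap z) * partialD χ i z := fun z => by
    rw [poisson, Finset.mul_sum]
    exact Finset.sum_congr rfl fun i _ => by ring
  have e2 : ∀ z, poisson a b z * χ z =
      ∑ i, partialD (fun z => coordSign i * (a z * partialD b i.swap z)) i z * χ z := fun z => by
    by_cases hz : z ∈ tsupport χ
    · rw [← Finset.sum_mul]
      congr 1
      have hz' := hχD hz
      have hd : ∀ i : Fin n ⊕ Fin n,
          partialD (fun z => coordSign i * (a z * partialD b i.swap z)) i z =
          coordSign i * partialD a i z * partialD b i.swap z +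
            a z * (coordSign i * partialD (partialD b i.swap) i z) := fun i => by
        have h1 := ((ha z hz').differentiableAt (by simp)).hasFDerivAt
        have h2 := hasFDerivAt_partialD (hb z hz') i.swap
        have h3 : fderiv ℝ (fun z => coordSign i * (a z * partialD b i.swap z)) z = _ :=
          ((h1.mul h2).const_mul (coordSign i)).fderiv
        have h4 := h2.fderiv
        change fderiv ℝ (fun z => coordSign i * (a z * partialD b i.swap z)) z (basisVec i) =
          coordSign i * fderiv ℝ a z (basisVec i) * partialD b i.swap z +
            a z * (coordSign i * fderiv ℝ (partialD b i.swap) z (basisVec i))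
        rw [h3, h4]
        simp
        ring
      simp only [hd, Finset.sum_add_distrib, ← Finset.mul_sum,
        sum_coordSign_second_deriv (hb z hz')]
      simp [poisson]
    · simp [image_eq_zero_of_notMem_tsupport hz]
  have i1 : ∀ i : Fin n ⊕ Fin n, Integrable
      (fun z => coordSign i * (a z * partialD b i.swap z) * partialD χ i z) := fun i =>
    integrable_mul_of_continuousOn hc.isCompact (measurable_partialD i)
      ⟨C, abs_partialD_le hχ i⟩ (fun z hz => partialD_eq_zero_of_notMem hz i)
      fun z hz => (hw i z (hχD hz)).continuousAt.continuousWithinAt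
  have i2 : ∀ i : Fin n ⊕ Fin n, Integrable
      (fun z => partialD (fun z => coordSign i * (a z * partialD b i.swap z)) i z * χ z) :=
    fun i => integrable_mul_of_continuousOn hc.isCompact hχ.continuous.measurable
      (exists_bound_of_lipschitz_compact hχ hc)
      (fun z hz => image_eq_zero_of_notMem_tsupport hz)
      fun z hz => ((((hw i z (hχD hz)).fderiv_right (m := 0) (by norm_num)).clm_apply
        contDiffAt_const).continuousAt).continuousWithinAt
  simp only [e1, e2]
  refine ⟨integrable_finsetSum _ fun i _ => i1 i, integrable_finsetSum _ fun i _ => i2 i, ?_⟩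
  rw [integral_finsetSum _ fun i _ => i1 i, integral_finsetSum _ fun i _ => i2 i,
    ← Finset.sum_neg_distrib]
  exact Finset.sum_congr rfl fun i _ => integral_mul_partialD hD hχ hc hχD (hw i) i

/-- The trilinear identity which expresses that `L` is skew-adjoint for the Poisson bracket. -/
theorem integral_poisson_cyclic (hD : IsOpen D) (hχ : LipschitzWith C χ)
    (hc : HasCompactSupport χ) (hχD : tsupport χ ⊆ D) {a b h : Phase n → ℝ}
    (ha : ContDiff ℝ ∞ a) (hb : ContDiff ℝ ∞ b) (hh : ∀ z ∈ D, ContDiffAt ℝ 2 h z) :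
    ∫ z, (poisson a b z * poisson χ h z - poisson a h z * poisson χ b z +
      poisson b h z * poisson χ a z) = 0 := by
  have h2 : ∀ {a : Phase n → ℝ}, ContDiff ℝ ∞ a → ∀ z ∈ D, ContDiffAt ℝ 2 a z :=
    fun ha z _ => (contDiff_infty.1 ha 2).contDiffAt
  -- Each product is integrated by parts so that the bracket with χ becomes an outer bracket times
  -- χ; the three integrands add up to χ times the Jacobi sum.
  obtain ⟨p1, q1, r1⟩ := integral_mul_poisson hD hχ hc hχD
    (fun z hz => contDiffAt_poisson (h2 ha z hz) (h2 hb z hz)) hh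
  obtain ⟨p2, q2, r2⟩ := integral_mul_poisson hD hχ hc hχD
    (fun z hz => contDiffAt_poisson (h2 ha z hz) (hh z hz)) (h2 hb)
  obtain ⟨p3, q3, r3⟩ := integral_mul_poisson hD hχ hc hχD
    (fun z hz => contDiffAt_poisson (h2 hb z hz) (hh z hz)) (h2 ha)
  have p12 : Integrable fun z => poisson a b z * poisson χ h z - poisson a h z * poisson χ b z :=
    p1.sub p2
  have q12 : Integrable fun z => poisson (poisson a b) h z * χ z -
      poisson (poisson a h) b z * χ z := q1.sub q2
  rw [integral_add p12 p3, integral_sub p1 p2, r1, r2, r3]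
  have h0 : ∫ z, (poisson (poisson a b) h z * χ z - poisson (poisson a h) b z * χ z +
      poisson (poisson b h) a z * χ z) = 0 := by
    rw [← integral_zero (Phase n) ℝ]
    refine integral_congr_ae (Eventually.of_forall fun z => ?_)
    by_cases hz : z ∈ tsupport χ
    · simp only
      linear_combination χ z * poisson_jacobi (h2 ha z (hχD hz)) (h2 hb z (hχD hz)) (hh z (hχD hz))
    · simp [image_eq_zero_of_notMem_tsupport hz]
  rw [integral_add q12 q3, integral_sub q1 q2] at h0
  linarith

/-- By the Leibniz rule the integrand is {χ a, b}, the divergence of a compactly supported field. -/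
theorem integral_poisson_parts (hD : IsOpen D) (hχ : LipschitzWith C χ)
    (hc : HasCompactSupport χ) (hχD : tsupport χ ⊆ D) {a b : Phase n → ℝ}
    (ha : ContDiff ℝ ∞ a) (hb : ContDiff ℝ ∞ b) :
    ∫ z, (χ z * poisson a b z + a z * poisson χ b z) = 0 := by
  obtain ⟨p, q, r⟩ := integral_mul_poisson hD hχ hc hχD
    (fun z _ => (contDiff_infty.1 ha 1).contDiffAt)
    (fun z _ => (contDiff_infty.1 hb 2).contDiffAt)
  simp only [mul_comm (χ _)]
  rw [integral_add q p, r]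
  ring

end Poisson

end PontryaginKoopman

end

noncomputable section

namespace PontryaginKoopman

open Filter Topology Set Convolution ContinuousLinearMap
open scoped NNReal

/-! ### The bracket identities on W_{1,2}(D) and their form on eigenfunctions -/

section WeakIdentities

variable {n : ℕ} {D : Set (Phase n)}

/-- The Poisson bracket of two elements of `W_{1,2}(D)`. -/
def weakPoisson (φ ψ : W12 D) (z : Phase n) : ℂ :=
  ∑ i, (coordSign i : ℂ) * gradOf φ i z * gradOf ψ i.swap z

/-- The components of the Hamiltonian vector field `Ω ∇b`. -/
def hamComp (b : Phase n → ℝ) (i : Fin n ⊕ Fin n) (z : Phase n) : ℝ :=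
  coordSign i * partialD b i.swap z

/-- The derivative of an element of `W_{1,2}(D)` along the Hamiltonian vector field of `b`. -/
def weakLie (b : Phase n → ℝ) (φ : W12 D) (z : Phase n) : ℂ :=
  ∑ i, (hamComp b i z : ℂ) * gradOf φ i z

theorem omega_eq_integral_weakPoisson (φ ψ : W12 D) :
    omega φ ψ = ∫ z in D, weakPoisson φ ψ z := by
  refine integral_congr_ae (Eventually.of_forall fun z => ?_)
  simp only [weakPoisson, Omega_eq, mul_ite, ite_mul, mul_zero, zero_mul, Finset.sum_ite_eq',
    Finset.mem_univ, if_true]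
  exact Finset.sum_congr rfl fun i _ => by ring

theorem weakPoisson_antisymm (φ ψ : W12 D) (z : Phase n) :
    weakPoisson φ ψ z = -weakPoisson ψ φ z := by
  rw [weakPoisson, ← sum_swap, weakPoisson, ← Finset.sum_neg_distrib]
  refine Finset.sum_congr rfl fun i _ => ?_
  rw [coordSign_swap, Sum.swap_swap]
  push_cast
  ring

theorem omega_antisymm (φ ψ : W12 D) : omega φ ψ = -omega ψ φ := by
  simp only [omega_eq_integral_weakPoisson, weakPoisson_antisymm φ ψ, integral_neg]

theorem integrable_weakPoisson (φ ψ : W12 D) :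
    Integrable (weakPoisson φ ψ) (volume.restrict D) := by
  refine integrable_finsetSum _ fun i _ => ?_
  have h : Integrable (fun z => gradOf φ i z * gradOf ψ i.swap z) (volume.restrict D) :=
    memLp_one_iff_integrable.1 ((Lp.memLp (gradOf ψ i.swap)).mul' (Lp.memLp (gradOf φ i)))
  simpa only [mul_assoc] using h.const_mul (coordSign i : ℂ)

theorem poisson_eq_sum_hamComp (a b : Phase n → ℝ) (z : Phase n) :
    poisson a b z = ∑ i, hamComp b i z * partialD a i z :=
  Finset.sum_congr rfl fun i _ => by rw [hamComp]; ring

theorem poisson_antisymm (a b : Phase n → ℝ) (z : Phase n) : poisson a b z = -poisson b a z := by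
  rw [poisson_eq_neg_sum, poisson]
  congr 1
  exact Finset.sum_congr rfl fun i _ => by ring

theorem poisson_eq_neg_sum_hamComp (a b : Phase n → ℝ) :
    poisson a b = fun z => ∑ i, -(hamComp a i z * partialD b i z) := by
  ext z
  rw [poisson_antisymm, poisson_eq_sum_hamComp, Finset.sum_neg_distrib]

/-- Pure algebra that recognizes a coefficient matrix as a combination of brackets. It is stated
over a commutative ring because it is applied to real jets and to complex weak jets. -/
theorem sum_bilinear_expand {R : Type*} [CommRing R] (σ a b H X : Fin n ⊕ Fin n → R) (S : R) :
    ∑ i, ∑ j, a i * (((if j = i.swap then σ i * S else 0) + (H i * X j - X i * H j)) * b j) =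
      (∑ i, σ i * a i * b i.swap) * S + ((∑ i, H i * a i) * (∑ j, X j * b j) -
        (∑ j, H j * b j) * (∑ i, X i * a i)) := by
  have h1 : ∀ i, ∑ j, a i * (((if j = i.swap then σ i * S else 0) +
      (H i * X j - X i * H j)) * b j) = σ i * a i * b i.swap * S +
      ((H i * a i) * (∑ j, X j * b j) - (X i * a i) * (∑ j, H j * b j)) := fun i => by
    have : ∀ j, a i * (((if j = i.swap then σ i * S else 0) + (H i * X j - X i * H j)) * b j) =
        (if j = i.swap then σ i * a i * b j * S else 0) +
        ((H i * a i) * (X j * b j) - (X i * a i) * (H j * b j)) := fun j => by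
      split_ifs <;> ring
    simp only [this, Finset.sum_add_distrib, Finset.sum_sub_distrib, Finset.sum_ite_eq',
      Finset.mem_univ, if_true, Finset.mul_sum]
  simp only [h1, Finset.sum_add_distrib, Finset.sum_sub_distrib, ← Finset.sum_mul]
  ring

variable {χ : Phase n → ℝ} {C : ℝ≥0}

theorem hamComp_eq_zero_of_notMem {z : Phase n} (hz : z ∉ tsupport χ) (i : Fin n ⊕ Fin n) :
    hamComp χ i z = 0 := by
  rw [hamComp, partialD_eq_zero_of_notMem hz, mul_zero]

theorem abs_coordSign (i : Fin n ⊕ Fin n) : ‖coordSign i‖ = 1 := by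
  cases i <;> simp [coordSign]

theorem memLp_hamComp_of_lipschitz (hχ : LipschitzWith C χ) (i : Fin n ⊕ Fin n)
    (K : Set (Phase n)) : MemLp (hamComp χ i) ⊤ (volume.restrict K) := by
  refine memLp_top_of_bound ((measurable_partialD _).const_mul _).aestronglyMeasurable C
    (Eventually.of_forall fun z => ?_)
  rw [hamComp, norm_mul, abs_coordSign, one_mul]
  exact abs_partialD_le hχ _ z

theorem memLp_top_of_continuousOn {K : Set (Phase n)} (hK : IsCompact K) {w : Phase n → ℝ}
    (hw : ContinuousOn w K) : MemLp w ⊤ (volume.restrict K) := by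
  obtain ⟨C, hC⟩ := hK.exists_bound_of_continuousOn hw
  exact memLp_top_of_bound (hw.aestronglyMeasurable hK.isClosed.measurableSet) C
    ((ae_restrict_mem hK.isClosed.measurableSet).mono hC)

theorem setIntegral_eq_of_support {E : Type*} [NormedAddCommGroup E] [NormedSpace ℝ E]
    (hD : IsOpen D) {K : Set (Phase n)} (hKD : K ⊆ D) {g : Phase n → E}
    (hg : ∀ z, z ∉ K → g z = 0) : ∫ z in D, g z = ∫ z in K, g z :=
  setIntegral_eq_of_subset_of_forall_sdiff_eq_zero hD.measurableSet hKD fun z hz => hg z hz.2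

/-- Weak form of `integral_poisson_parts`: `weakLie χ ψ` plays the role of {ψ, χ} = -{χ, ψ}, which
accounts for the sign. -/
theorem integral_weakPoisson_parts (hD : IsOpen D) (hχ : LipschitzWith C χ)
    (hc : HasCompactSupport χ) (hχD : tsupport χ ⊆ D) (φ ψ : W12 D) :
    ∫ z in D, (χ z : ℂ) * weakPoisson φ ψ z = ∫ z in D, fnOf φ z * weakLie χ ψ z := by
  set K := tsupport χ with hK
  have hKc : IsCompact K := hc.isCompact
  -- Coefficients for which the bilinear form in the jets of A and B is χ {A, B} + A {χ, B}; the
  -- index `none` stands for the function itself.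
  set c : Option (Fin n ⊕ Fin n) → Option (Fin n ⊕ Fin n) → Phase n → ℝ := fun s t =>
    match s, t with
    | none, none => fun _ => 0
    | some _, none => fun _ => 0
    | none, some j => fun z => -hamComp χ j z
    | some i, some j => fun z => if j = i.swap then coordSign i * χ z else 0 with hcdef
  have hcm : ∀ s t, MemLp (c s t) ⊤ (volume.restrict K) := by
    rintro (_ | i) (_ | j)
    · exact MemLp.zero
    · exact (memLp_hamComp_of_lipschitz hχ j K).neg
    · exact MemLp.zero
    · refine memLp_top_of_continuousOn hKc ?_
      have := hχ.continuous.continuousOn (s := K)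
      by_cases h : j = i.swap <;> simp only [hcdef, h, if_true, if_false] <;> fun_prop
  have hreal : ∀ A B : Phase n → ℝ, ContDiff ℝ ∞ A → ContDiff ℝ ∞ B →
      ∫ z in K, ∑ s, ∑ t, jet A s z * (c s t z * jet B t z) = 0 := fun A B hA hB => by
    refine Eq.trans ?_ ((setIntegral_eq_integral_of_forall_compl_eq_zero (s := K) ?_).trans
      (integral_poisson_parts hD hχ hc hχD hA hB))
    · refine integral_congr_ae (Eventually.of_forall fun z => ?_)
      simp only [Fintype.sum_option, hcdef, jet]
      rw [poisson_antisymm χ B, poisson_eq_sum_hamComp B χ, poisson]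
      simp only [partialD, zero_mul, mul_zero, zero_add, ite_mul, mul_ite, Finset.sum_ite_eq',
        Finset.mem_univ, if_true]
      rw [add_comm, Finset.mul_sum, ← Finset.sum_neg_distrib, Finset.mul_sum]
      congr 1
      · exact Finset.sum_congr rfl fun i _ => by ring
      · exact Finset.sum_congr rfl fun i _ => by ring
    · intro z hz
      rw [poisson_antisymm χ B, poisson_eq_sum_hamComp B χ]
      simp [image_eq_zero_of_notMem_tsupport hz, hamComp_eq_zero_of_notMem hz]
  have h := integral_weakJet_bilinear hD hKc hχD hcm hreal φ ψ
  have hφ : ∀ i, MemLp (gradOf φ i : Phase n → ℂ) 2 (volume.restrict K) := fun i =>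
    (Lp.memLp (gradOf φ i)).mono_measure (Measure.restrict_mono_set _ hχD)
  rw [setIntegral_eq_of_support hD hχD fun z hz => by simp [image_eq_zero_of_notMem_tsupport hz],
    setIntegral_eq_of_support hD hχD fun z hz => by
      simp [weakLie, hamComp_eq_zero_of_notMem hz], ← sub_eq_zero, ← integral_sub, ← h]
  · refine integral_congr_ae (Eventually.of_forall fun z => ?_)
    simp only [Fintype.sum_option, hcdef, weakJet, weakPoisson, weakLie]
    simp only [Complex.ofReal_zero, zero_mul, mul_zero, zero_add, apply_ite Complex.ofReal,
      ite_mul, mul_ite, Finset.sum_ite_eq', Finset.mem_univ, if_true]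
    rw [sub_eq_add_neg, add_comm, Finset.mul_sum, Finset.mul_sum, ← Finset.sum_neg_distrib]
    congr 1
    · exact Finset.sum_congr rfl fun i _ => by push_cast; ring
    · exact Finset.sum_congr rfl fun i _ => by push_cast; ring
  · have h1 := (integrable_weakPoisson φ ψ).mono_measure (Measure.restrict_mono_set volume hχD)
    obtain ⟨M, hM⟩ := exists_bound_of_lipschitz_compact hχ hc
    refine h1.bdd_mul (c := M) (Complex.continuous_ofReal.comp
      hχ.continuous).aestronglyMeasurable (Eventually.of_forall fun z => ?_)
    simpa using hM z
  · simp only [weakLie, Finset.mul_sum]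
    refine integrable_finsetSum _ fun i _ => ?_
    exact integrable_coef_mul (memLp_hamComp_of_lipschitz hχ i K)
      ((Lp.memLp (fnOf φ)).mono_measure (Measure.restrict_mono_set _ hχD))
      ((Lp.memLp (gradOf ψ i)).mono_measure (Measure.restrict_mono_set _ hχD))

/-- The Jacobi identity involves second derivatives, but its integrated form
`integral_poisson_cyclic` contains only first derivatives of the two functions, with coefficients
bounded on the support of χ. It therefore passes to weak jets. -/
theorem integral_weakPoisson_cyclic (hD : IsOpen D) (hχ : LipschitzWith C χ)
    (hc : HasCompactSupport χ) (hχD : tsupport χ ⊆ D) {h : Phase n → ℝ}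
    (hh : ∀ z ∈ D, ContDiffAt ℝ 2 h z) (φ ψ : W12 D) :
    ∫ z in D, (weakPoisson φ ψ z * (poisson χ h z : ℂ) +
      (weakLie h φ z * weakLie χ ψ z - weakLie h ψ z * weakLie χ φ z)) = 0 := by
  set K := tsupport χ with hK
  have hKc : IsCompact K := hc.isCompact
  set c : Option (Fin n ⊕ Fin n) → Option (Fin n ⊕ Fin n) → Phase n → ℝ := fun s t =>
    match s, t with
    | none, _ => fun _ => 0
    | some _, none => fun _ => 0
    | some i, some j => fun z => (if j = i.swap then coordSign i * poisson χ h z else 0) +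
        (hamComp h i z * hamComp χ j z - hamComp χ i z * hamComp h j z) with hcdef
  have hX := fun i => memLp_hamComp_of_lipschitz (i := i) hχ (K := K)
  have hH : ∀ i, MemLp (hamComp h i) ⊤ (volume.restrict K) := fun i =>
    memLp_top_of_continuousOn hKc fun z hz => ((contDiffAt_const.mul
      (contDiffAt_partialD (hh z (hχD hz)) i.swap)).continuousAt).continuousWithinAt
  have hS : MemLp (poisson χ h) ⊤ (volume.restrict K) := by
    rw [poisson_eq_neg_sum_hamComp]
    refine memLp_finsetSum _ fun i _ => (MemLp.mul' (p := ⊤) (q := ⊤) (r := ⊤) ?_ (hX i)).neg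
    exact memLp_top_of_continuousOn hKc fun z hz =>
      (contDiffAt_partialD (hh z (hχD hz)) i).continuousAt.continuousWithinAt
  have hcm : ∀ s t, MemLp (c s t) ⊤ (volume.restrict K) := by
    rintro (_ | i) (_ | j)
    · exact MemLp.zero
    · exact MemLp.zero
    · exact MemLp.zero
    · refine MemLp.add ?_ (((hX j).mul' (hH i)).sub ((hH j).mul' (hX i)))
      by_cases h : j = i.swap
      · simpa only [h, if_true] using hS.const_mul _
      · simpa only [h, if_false] using MemLp.zero'
  have hreal : ∀ A B : Phase n → ℝ, ContDiff ℝ ∞ A → ContDiff ℝ ∞ B →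
      ∫ z in K, ∑ s, ∑ t, jet A s z * (c s t z * jet B t z) = 0 := fun A B hA hB => by
    refine Eq.trans ?_ ((setIntegral_eq_integral_of_forall_compl_eq_zero (s := K) ?_).trans
      (integral_poisson_cyclic hD hχ hc hχD hA hB hh))
    · refine integral_congr_ae (Eventually.of_forall fun z => ?_)
      simp only [Fintype.sum_option, hcdef, jet, zero_mul, mul_zero, zero_add,
        Finset.sum_const_zero, sum_bilinear_expand]
      rw [poisson_antisymm χ B, poisson_antisymm χ A, poisson_eq_sum_hamComp A h,
        poisson_eq_sum_hamComp B χ, poisson_eq_sum_hamComp B h, poisson_eq_sum_hamComp A χ,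
        poisson.eq_1 A B]
      simp only [partialD]
      ring
    · intro z hz
      rw [poisson_antisymm χ B, poisson_antisymm χ A, poisson_antisymm χ h,
        poisson_eq_sum_hamComp B χ, poisson_eq_sum_hamComp A χ, poisson_eq_sum_hamComp h χ]
      simp [hamComp_eq_zero_of_notMem hz]
  have hmain := integral_weakJet_bilinear hD hKc hχD hcm hreal φ ψ
  rw [setIntegral_eq_of_support hD hχD fun z hz => by
      rw [poisson_antisymm χ h, poisson_eq_sum_hamComp h χ]
      simp [weakLie, hamComp_eq_zero_of_notMem hz], ← hmain]
  refine integral_congr_ae (Eventually.of_forall fun z => ?_)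
  simp only [Fintype.sum_option, hcdef, weakJet, weakPoisson, weakLie, Complex.ofReal_zero,
    zero_mul, mul_zero, zero_add, Finset.sum_const_zero, Complex.ofReal_add, Complex.ofReal_sub,
    Complex.ofReal_mul, apply_ite Complex.ofReal, sum_bilinear_expand]

/-- Localized skew-adjointness of `L` on eigenfunctions. -/
theorem eigen_integral_weakPoisson (hD : IsOpen D) (hχ : LipschitzWith C χ)
    (hc : HasCompactSupport χ) (hχD : tsupport χ ⊆ D) {h : Phase n → ℝ}
    (hh : ∀ z ∈ D, ContDiffAt ℝ 2 h z) {φ ψ : W12 D} {κ μ : ℂ}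
    (hφ : ∀ᵐ z ∂(volume.restrict D), weakLie h φ z = κ * fnOf φ z)
    (hψ : ∀ᵐ z ∂(volume.restrict D), weakLie h ψ z = μ * fnOf ψ z) :
    (κ + μ) * ∫ z in D, (χ z : ℂ) * weakPoisson φ ψ z =
      -∫ z in D, weakPoisson φ ψ z * (poisson χ h z : ℂ) := by
  have hint : ∀ φ ψ : W12 D,
      Integrable (fun z => fnOf φ z * weakLie χ ψ z) (volume.restrict D) := fun φ ψ => by
    simp only [weakLie, Finset.mul_sum]
    exact integrable_finsetSum _ fun i _ => memLp_one_iff_integrable.1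
      ((MemLp.mul' (p := ⊤) (q := 2) (r := 2) (Lp.memLp (gradOf ψ i))
        ((memLp_hamComp_of_lipschitz hχ i D).ofReal (K := ℂ))).mul' (Lp.memLp (fnOf φ)))
  -- On eigenfunctions the derivatives along h become the factors κ and μ; integration by parts
  -- turns what remains into ∫ χ {φ, ψ}, and antisymmetry makes the two factors add up.
  have hcyc := integral_weakPoisson_cyclic hD hχ hc hχD hh φ ψ
  have h1 := integral_weakPoisson_parts hD hχ hc hχD φ ψ
  have h2 := integral_weakPoisson_parts hD hχ hc hχD ψ φ
  have h2' : ∫ z in D, (χ z : ℂ) * weakPoisson ψ φ z =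
      -∫ z in D, (χ z : ℂ) * weakPoisson φ ψ z := by
    simp only [weakPoisson_antisymm ψ φ, mul_neg, integral_neg]
  have hi1 : Integrable (fun z => weakLie h φ z * weakLie χ ψ z) (volume.restrict D) := by
    refine ((hint φ ψ).const_mul κ).congr ?_
    filter_upwards [hφ] with z hz
    rw [hz]; ring
  have hi2 : Integrable (fun z => weakLie h ψ z * weakLie χ φ z) (volume.restrict D) := by
    refine ((hint ψ φ).const_mul μ).congr ?_
    filter_upwards [hψ] with z hz
    rw [hz]; ring
  have e1 : ∫ z in D, weakLie h φ z * weakLie χ ψ z =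
      κ * ∫ z in D, fnOf φ z * weakLie χ ψ z := by
    rw [← integral_const_mul]
    refine integral_congr_ae ?_
    filter_upwards [hφ] with z hz
    rw [hz]; ring
  have e2 : ∫ z in D, weakLie h ψ z * weakLie χ φ z =
      μ * ∫ z in D, fnOf ψ z * weakLie χ φ z := by
    rw [← integral_const_mul]
    refine integral_congr_ae ?_
    filter_upwards [hψ] with z hz
    rw [hz]; ring
  have hi12 : Integrable (fun z => weakLie h φ z * weakLie χ ψ z -
      weakLie h ψ z * weakLie χ φ z) (volume.restrict D) := hi1.sub hi2
  -- Integrability, needed to split the integral, always holds: {χ, h} is bounded, being zero off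
  -- the compact support of χ. The second branch is therefore contradictory.
  by_cases hi : Integrable (fun z => weakPoisson φ ψ z * (poisson χ h z : ℂ)) (volume.restrict D)
  · rw [integral_add hi hi12, integral_sub hi1 hi2, e1, e2, ← h1, ← h2, h2'] at hcyc
    linear_combination hcyc
  · exfalso
    apply hi
    have hb : ∃ M, ∀ z, ‖poisson χ h z‖ ≤ M := by
      have hcont : ContinuousOn (fun z => ∑ i, ‖partialD h i z‖) (tsupport χ) :=
        fun z hz => ContinuousAt.continuousWithinAt (tendsto_finsetSum _ fun i _ =>
          (contDiffAt_partialD (hh z (hχD hz)) i).continuousAt.norm)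
      obtain ⟨M, hM⟩ := hc.isCompact.exists_bound_of_continuousOn hcont
      refine ⟨max (C * M) 0, fun z => ?_⟩
      rw [poisson_antisymm, poisson_eq_sum_hamComp, norm_neg]
      by_cases hz : z ∈ tsupport χ
      · refine le_trans ?_ (le_max_left _ _)
        refine le_trans (norm_sum_le _ _) ?_
        have hle : ∀ i ∈ (Finset.univ : Finset (Fin n ⊕ Fin n)),
            ‖hamComp χ i z * partialD h i z‖ ≤ C * ‖partialD h i z‖ := fun i _ => by
          rw [norm_mul, hamComp, norm_mul, abs_coordSign, one_mul]
          exact mul_le_mul_of_nonneg_right (abs_partialD_le hχ _ z) (norm_nonneg _)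
        refine (Finset.sum_le_sum hle).trans ?_
        rw [← Finset.mul_sum]
        exact mul_le_mul_of_nonneg_left ((le_abs_self _).trans (hM z hz)) C.coe_nonneg
      · simp [hamComp_eq_zero_of_notMem hz]
    obtain ⟨M, hM⟩ := hb
    have hmeas : AEStronglyMeasurable (fun z => (poisson χ h z : ℂ)) (volume.restrict D) := by
      refine Complex.continuous_ofReal.comp_aestronglyMeasurable ?_
      rw [poisson_eq_neg_sum_hamComp]
      exact (Finset.measurable_sum _ fun i _ => (((measurable_partialD _).const_mul _).mul
        (measurable_partialD i)).neg).aestronglyMeasurable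
    exact (integrable_weakPoisson φ ψ).mul_bdd (c := M) hmeas
      (Eventually.of_forall fun z => by simpa using hM z)

end WeakIdentities

end PontryaginKoopman

end

noncomputable section

namespace PontryaginKoopman

open Filter Topology Set Convolution ContinuousLinearMap
open scoped NNReal

/-! ### Dependence of orbits on initial values, and averages along the flow -/

section Flow

variable {E : Type*} [NormedAddCommGroup E] [NormedSpace ℝ E] {F : E → E} {D : Set E}

/-- `y` is a solution of `y' = F(y)` which exists for all times and stays in `D`. -/
def IsOrbit (F : E → E) (D : Set E) (y : ℝ → E) : Prop :=
  ∀ t, y t ∈ D ∧ HasDerivAt y (F (y t)) t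

theorem IsOrbit.continuous {y : ℝ → E} (hy : IsOrbit F D y) : Continuous y :=
  continuous_iff_continuousAt.2 fun t => (hy t).2.continuousAt

theorem IsOrbit.shift {y : ℝ → E} (hy : IsOrbit F D y) (c : ℝ) :
    IsOrbit F D fun t => y (t + c) :=
  fun t => ⟨(hy (t + c)).1, (hy (t + c)).2.comp_add_const t c⟩

theorem IsOrbit.reverse {y : ℝ → E} (hy : IsOrbit F D y) :
    IsOrbit (fun z => -F z) D fun t => y (-t) := fun t => by
  refine ⟨(hy (-t)).1, ?_⟩
  have := (hy (-t)).2.scomp t (hasDerivAt_neg t)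
  simpa using! this

/-- Near w the field is Lipschitz and has speed below M, so orbits starting close to w remain in the
good ball for a common time, during which Grönwall's inequality applies. -/
theorem IsOrbit.exists_local_bound {w : E} (hF : ContDiffAt ℝ 1 F w) :
    ∃ r > 0, ∃ ε > 0, ∃ L ≥ (0 : ℝ), ∀ y₁ y₂ : ℝ → E, IsOrbit F D y₁ → IsOrbit F D y₂ →
      dist (y₁ 0) w < r → dist (y₂ 0) w < r →
      ∀ s ∈ Icc 0 ε, dist (y₁ s) (y₂ s) ≤ L * dist (y₁ 0) (y₂ 0) := by
  obtain ⟨K, U, hU, hLip⟩ := hF.exists_lipschitzOnWith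
  set M := ‖F w‖ + 1 with hM
  have hMpos : 0 < M := by positivity
  have hbd : ∀ᶠ z in 𝓝 w, ‖F z‖ < M :=
    hF.continuousAt.norm.eventually_lt_const (lt_add_one _)
  obtain ⟨R, hR, hball⟩ := Metric.mem_nhds_iff.1 (inter_mem hU hbd)
  -- At speed below M an orbit moves at most R/4 in this time, hence starting within R/2 of w it
  -- stays within R.
  have hε : 0 < R / (4 * M) := by positivity
  have hstay : ∀ y : ℝ → E, IsOrbit F D y → dist (y 0) w < R / 2 →
      ∀ s ∈ Icc 0 (R / (4 * M)), y s ∈ Metric.ball w R := by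
    intro y hy hy0 s hs
    have hB : ∀ x ∈ Icc 0 (R / (4 * M)), R / 2 + M * x < R := fun x hx => by
      have : M * x ≤ M * (R / (4 * M)) := mul_le_mul_of_nonneg_left hx.2 hMpos.le
      have h2 : M * (R / (4 * M)) = R / 4 := by field_simp
      linarith
    have key := image_norm_le_of_norm_deriv_right_lt_deriv_boundary (f := fun t => y t - w)
      (f' := fun t => F (y t)) (B := fun t => R / 2 + M * t) (B' := fun _ => M)
      ((hy.continuous.sub continuous_const).continuousOn (s := Icc 0 (R / (4 * M))))
      (fun x _ => ((hy x).2.sub_const w).hasDerivWithinAt)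
      (by simpa [dist_eq_norm] using hy0.le)
      (fun x => by simpa using ((hasDerivAt_id x).const_mul M).const_add (R / 2))
      (fun x hx heq => by
        have hx' := hB x ⟨hx.1, hx.2.le⟩
        exact (hball (by rw [Metric.mem_ball, dist_eq_norm]; exact heq.le.trans_lt hx')).2)
    rw [Metric.mem_ball, dist_eq_norm]
    exact (key hs).trans_lt (hB s hs)
  refine ⟨R / 2, by positivity, R / (4 * M), hε, Real.exp (K * (R / (4 * M))),
    (Real.exp_pos _).le, fun y₁ y₂ h₁ h₂ h₁0 h₂0 s hs => ?_⟩
  have key := dist_le_of_trajectories_ODE_of_mem (v := fun _ => F) (K := K) (s := fun _ => U)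
    (a := 0) (b := R / (4 * M)) (f := y₁) (g := y₂) (δ := dist (y₁ 0) (y₂ 0))
    (fun _ _ => hLip) h₁.continuous.continuousOn (fun t _ => (h₁ t).2.hasDerivWithinAt)
    (fun t ht => (hball (hstay y₁ h₁ h₁0 t ⟨ht.1, ht.2.le⟩)).1) h₂.continuous.continuousOn
    (fun t _ => (h₂ t).2.hasDerivWithinAt)
    (fun t ht => (hball (hstay y₂ h₂ h₂0 t ⟨ht.1, ht.2.le⟩)).1) le_rfl s hs
  refine key.trans ?_
  rw [mul_comm]
  gcongr
  linarith [hs.2]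

/-- Orbits depend locally Lipschitz continuously on their initial value, on compact time
intervals. -/
theorem IsOrbit.exists_bound (hF : ∀ z ∈ D, ContDiffAt ℝ 1 F z) {y₀ : ℝ → E}
    (h₀ : IsOrbit F D y₀) (T : ℝ) :
    ∃ δ > 0, ∃ L ≥ (0 : ℝ), ∀ y₁ y₂ : ℝ → E, IsOrbit F D y₁ → IsOrbit F D y₂ →
      dist (y₁ 0) (y₀ 0) < δ → dist (y₂ 0) (y₀ 0) < δ →
      ∀ s ∈ Icc 0 T, dist (y₁ s) (y₂ s) ≤ L * dist (y₁ 0) (y₂ 0) := by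
  set P : ℝ → Prop := fun T => ∃ δ > 0, ∃ L ≥ (0 : ℝ), ∀ y₁ y₂ : ℝ → E, IsOrbit F D y₁ →
    IsOrbit F D y₂ → dist (y₁ 0) (y₀ 0) < δ → dist (y₂ 0) (y₀ 0) < δ →
      ∀ s ∈ Icc 0 T, dist (y₁ s) (y₂ s) ≤ L * dist (y₁ 0) (y₂ 0) with hP
  change P T
  have hmono : ∀ {a b : ℝ}, a ≤ b → P b → P a := by
    rintro a b hab ⟨δ, hδ, L, hL, h⟩
    exact ⟨δ, hδ, L, hL, fun y₁ y₂ h₁ h₂ d₁ d₂ s hs => h y₁ y₂ h₁ h₂ d₁ d₂ s ⟨hs.1, hs.2.trans hab⟩⟩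
  have hP0 : P 0 := ⟨1, one_pos, 1, zero_le_one, fun y₁ y₂ _ _ _ _ s hs => by
    obtain rfl : s = 0 := le_antisymm hs.2 hs.1
    rw [one_mul]⟩
  -- Continuation argument: the gain ε depends on t₀ only and works for all t₁ near it. With t₀ the
  -- supremum of the admissible times, one step from a nearby t₁ passes the supremum.
  have hstep : ∀ t₀ : ℝ, ∃ ε > 0, ∀ t₁, |t₁ - t₀| < ε → 0 ≤ t₁ → P t₁ → P (t₁ + ε) := by
    intro t₀
    obtain ⟨r, hr, ε, hε, L₀, hL₀, hloc⟩ :=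
      IsOrbit.exists_local_bound (D := D) (hF (y₀ t₀) (h₀ t₀).1)
    obtain ⟨η, hη, hcont⟩ := Metric.continuous_iff.1 h₀.continuous t₀ (r / 2) (half_pos hr)
    refine ⟨min η ε, lt_min hη hε, fun t₁ ht₁ ht₁0 => ?_⟩
    rintro ⟨δ, hδ, L, hL, h⟩
    have hL1 : 0 < L + 1 := by linarith
    -- The second radius keeps L times the initial distance below r/2, so at time t₁ the orbits are
    -- within reach of the local bound at `y₀ t₀`. Using L + 1 avoids division by zero.
    refine ⟨min δ (r / (2 * (L + 1))), lt_min hδ (by positivity), max L (L₀ * L),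
      le_max_of_le_left hL, fun y₁ y₂ h₁ h₂ d₁ d₂ s hs => ?_⟩
    rcases le_or_gt s t₁ with hst | hst
    · refine (h y₁ y₂ h₁ h₂ (d₁.trans_le (min_le_left _ _)) (d₂.trans_le (min_le_left _ _)) s
        ⟨hs.1, hst⟩).trans ?_
      exact mul_le_mul_of_nonneg_right (le_max_left _ _) dist_nonneg
    · have hnear : ∀ y : ℝ → E, IsOrbit F D y → dist (y 0) (y₀ 0) < min δ (r / (2 * (L + 1))) →
          dist (y (0 + t₁)) (y₀ t₀) < r := fun y hy hd => by
        have e1 := h y y₀ hy h₀ (hd.trans_le (min_le_left _ _)) (by simpa using hδ) t₁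
          ⟨ht₁0, le_rfl⟩
        have e2 := hcont t₁ (by rw [Real.dist_eq]; exact ht₁.trans_le (min_le_left _ _))
        have e3 : L * dist (y 0) (y₀ 0) ≤ r / 2 := by
          have h1 : dist (y 0) (y₀ 0) ≤ r / (2 * (L + 1)) := (hd.trans_le (min_le_right _ _)).le
          calc L * dist (y 0) (y₀ 0) ≤ (L + 1) * (r / (2 * (L + 1))) := by
                gcongr; linarith
            _ = r / 2 := by field_simp
        rw [zero_add]
        calc _ ≤ dist (y t₁) (y₀ t₁) + dist (y₀ t₁) (y₀ t₀) := dist_triangle _ _ _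
          _ < r := by linarith
      have hs2 : s - t₁ ∈ Icc 0 ε :=
        ⟨by linarith, by have := min_le_right η ε; linarith [hs.2]⟩
      have e4 := hloc _ _ (h₁.shift t₁) (h₂.shift t₁) (hnear y₁ h₁ d₁) (hnear y₂ h₂ d₂) (s - t₁) hs2
      simp only [sub_add_cancel, zero_add] at e4
      have e5 := h y₁ y₂ h₁ h₂ (d₁.trans_le (min_le_left _ _)) (d₂.trans_le (min_le_left _ _)) t₁
        ⟨ht₁0, le_rfl⟩
      calc dist (y₁ s) (y₂ s) ≤ L₀ * dist (y₁ t₁) (y₂ t₁) := e4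
        _ ≤ L₀ * (L * dist (y₁ 0) (y₂ 0)) := by gcongr
        _ = (L₀ * L) * dist (y₁ 0) (y₂ 0) := by ring
        _ ≤ _ := mul_le_mul_of_nonneg_right (le_max_right _ _) dist_nonneg
  by_contra hT
  set S : Set ℝ := {t | 0 ≤ t ∧ P t} with hS
  have hbdd : BddAbove S := ⟨T, fun t ht => by
    by_contra hlt
    exact hT (hmono (not_le.1 hlt).le ht.2)⟩
  have hne : S.Nonempty := ⟨0, le_rfl, hP0⟩
  obtain ⟨ε, hε, hstep'⟩ := hstep (sSup S)
  obtain ⟨t₁, ht₁, hlt⟩ := exists_lt_of_lt_csSup hne (sub_lt_self (sSup S) hε)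
  have hle := le_csSup hbdd ht₁
  have hP1 := hstep' t₁ (by rw [abs_lt]; constructor <;> linarith) ht₁.1 ht₁.2
  have := le_csSup hbdd (show t₁ + ε ∈ S from ⟨by linarith [ht₁.1], hP1⟩)
  linarith

theorem IsOrbit.eq_of_nonneg (hF : ∀ z ∈ D, ContDiffAt ℝ 1 F z) {y₁ y₂ : ℝ → E}
    (h₁ : IsOrbit F D y₁) (h₂ : IsOrbit F D y₂) (h : y₁ 0 = y₂ 0) {t : ℝ} (ht : 0 ≤ t) :
    y₁ t = y₂ t := by
  obtain ⟨δ, hδ, L, -, hL⟩ := h₁.exists_bound hF t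
  have := hL y₁ y₂ h₁ h₂ (by simpa using hδ) (by simpa [h] using hδ) t ⟨ht, le_rfl⟩
  rw [h, dist_self, mul_zero] at this
  exact dist_le_zero.1 this

theorem IsOrbit.eq (hF : ∀ z ∈ D, ContDiffAt ℝ 1 F z) {y₁ y₂ : ℝ → E}
    (h₁ : IsOrbit F D y₁) (h₂ : IsOrbit F D y₂) (h : y₁ 0 = y₂ 0) (t : ℝ) : y₁ t = y₂ t := by
  rcases le_total 0 t with ht | ht
  · exact h₁.eq_of_nonneg hF h₂ h ht
  · have := h₁.reverse.eq_of_nonneg (fun z hz => (hF z hz).neg) h₂.reverse (by simpa using h)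
      (neg_nonneg.2 ht)
    simpa using this

/-- Triangle inequality through `Y z₀ t`: Lipschitz dependence on the initial value, plus continuity
of the single orbit of z₀ in time. -/
theorem IsOrbit.continuousOn_flow (hF : ∀ z ∈ D, ContDiffAt ℝ 1 F z)
    {Y : E → ℝ → E} (hY0 : ∀ z ∈ D, Y z 0 = z) (hY : ∀ z ∈ D, IsOrbit F D (Y z)) (T : ℝ) :
    ContinuousOn (fun p : ℝ × E => Y p.2 p.1) (Icc 0 T ×ˢ D) := by
  rintro ⟨t₀, z₀⟩ ⟨ht₀, hz₀⟩
  obtain ⟨δ, hδ, L, -, hL⟩ := (hY z₀ hz₀).exists_bound hF T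
  refine tendsto_iff_dist_tendsto_zero.2 ?_
  have hlim : Tendsto (fun p : ℝ × E => L * dist p.2 z₀ + dist (Y z₀ p.1) (Y z₀ t₀))
      (𝓝[Icc 0 T ×ˢ D] (t₀, z₀)) (𝓝 0) := by
    have hc : Continuous fun p : ℝ × E => L * dist p.2 z₀ + dist (Y z₀ p.1) (Y z₀ t₀) := by
      have := (hY z₀ hz₀).continuous
      fun_prop
    have := hc.tendsto (t₀, z₀)
    simp only [dist_self, mul_zero, add_zero] at this
    exact this.mono_left nhdsWithin_le_nhds
  refine squeeze_zero' (Eventually.of_forall fun _ => dist_nonneg) ?_ hlim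
  have hnear : ∀ᶠ p : ℝ × E in 𝓝[Icc 0 T ×ˢ D] (t₀, z₀), dist p.2 z₀ < δ :=
    nhdsWithin_le_nhds ((continuous_snd.dist continuous_const).continuousAt.eventually_lt
      continuousAt_const (by simpa using hδ))
  filter_upwards [hnear, self_mem_nhdsWithin] with p hp hpm
  have e := hL (Y p.2) (Y z₀) (hY _ hpm.2) (hY _ hz₀)
    (by rwa [hY0 _ hpm.2, hY0 _ hz₀]) (by simpa using hδ) p.1 hpm.1
  rw [hY0 _ hpm.2, hY0 _ hz₀] at e
  exact (dist_triangle _ (Y z₀ p.1) _).trans (add_le_add_left e _)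

/-- A locally Lipschitz function with compact support is Lipschitz. -/
theorem exists_lipschitzWith_of_locallyLipschitz {G : Type*} [PseudoMetricSpace G]
    [ProperSpace G] [Nonempty G] {χ : G → ℝ}
    (hχ : LocallyLipschitz χ) (hc : HasCompactSupport χ) : ∃ C, LipschitzWith C χ := by
  set K := Metric.cthickening 1 (tsupport χ) with hK
  have hKc : IsCompact K := hc.isCompact.cthickening
  obtain ⟨C, hC⟩ := hχ.locallyLipschitzOn.exists_lipschitzOnWith_of_compact hKc
  obtain ⟨M, hM⟩ := hc.exists_bound_of_continuous hχ.continuous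
  have hMnn : 0 ≤ M := (norm_nonneg _).trans (hM (Classical.arbitrary G))
  have hsub : tsupport χ ⊆ K := Metric.self_subset_cthickening _
  -- Pairs leaving the compact thickening K are at distance at least 1 from the support, so there
  -- the sup bound M serves as a Lipschitz constant.
  have hfar : ∀ x ∈ tsupport χ, ∀ y, y ∉ K → 1 ≤ dist x y := fun x hx y hy => by
    by_contra h
    exact hy (Metric.mem_cthickening_of_dist_le y x 1 _ hx (by rw [dist_comm]; exact (not_le.1 h).le))
  refine ⟨C + M.toNNReal, LipschitzWith.of_dist_le_mul fun x y => ?_⟩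
  push_cast
  rw [Real.coe_toNNReal M hMnn, add_mul]
  have hmix : ∀ x y, x ∈ K → y ∉ K → dist (χ x) (χ y) ≤ M * dist x y := fun x y _ hy => by
    have hy0 : χ y = 0 := image_eq_zero_of_notMem_tsupport fun h => hy (hsub h)
    by_cases hx : x ∈ tsupport χ
    · rw [hy0, dist_zero_right]
      exact (hM x).trans (le_mul_of_one_le_right hMnn (hfar x hx y hy))
    · rw [hy0, image_eq_zero_of_notMem_tsupport hx, dist_self]
      positivity
  have hnn1 : 0 ≤ (C : ℝ) * dist x y := by positivity
  have hnn2 : 0 ≤ M * dist x y := by positivity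
  by_cases hx : x ∈ K <;> by_cases hy : y ∈ K
  · linarith [hC.dist_le_mul x hx y hy]
  · linarith [hmix x y hx hy]
  · have := hmix y x hy hx
    rw [dist_comm, dist_comm y x] at this
    linarith
  · have hx0 : χ x = 0 := image_eq_zero_of_notMem_tsupport fun h => hx (hsub h)
    have hy0 : χ y = 0 := image_eq_zero_of_notMem_tsupport fun h => hy (hsub h)
    rw [hx0, hy0, dist_self]
    linarith

/-- Averaging a cutoff function along the flow. -/
theorem exists_flow_average [ProperSpace E] (hD : IsOpen D) (hF : ∀ z ∈ D, ContDiffAt ℝ 1 F z)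
    {Y : E → ℝ → E} (hY0 : ∀ z ∈ D, Y z 0 = z) (hY : ∀ z ∈ D, IsOrbit F D (Y z)) {η : E → ℝ}
    {M : ℝ≥0} (hη : LipschitzWith M η) (hηc : HasCompactSupport η) (hηD : tsupport η ⊆ D) :
    ∃ χ : E → ℝ, (∃ C, LipschitzWith C χ) ∧ HasCompactSupport χ ∧ tsupport χ ⊆ D ∧
      (∀ z ∈ D, χ z = ∫ t in (0 : ℝ)..1, η (Y z t)) ∧
      ∀ z ∈ D, DifferentiableAt ℝ χ z → fderiv ℝ χ z (F z) = η (Y z 1) - η z := by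
  classical
  set χ : E → ℝ := fun z => if z ∈ D then ∫ t in (0 : ℝ)..1, η (Y z t) else 0 with hχ
  have hχD : ∀ z ∈ D, χ z = ∫ t in (0 : ℝ)..1, η (Y z t) := fun z hz => if_pos hz
  have hcont : ∀ z ∈ D, Continuous fun t => η (Y z t) := fun z hz =>
    hη.continuous.comp (hY z hz).continuous
  -- The points that reach the support of η within unit time: the image of a compact set under the
  -- reversed flow. The average vanishes off S.
  set S : Set E := (fun p : ℝ × E => Y p.2 (-p.1)) '' (Icc (0 : ℝ) 1 ×ˢ tsupport η) with hS
  have hSc : IsCompact S := by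
    refine (isCompact_Icc.prod hηc.isCompact).image_of_continuousOn ?_
    refine (IsOrbit.continuousOn_flow (F := fun z => -F z) (Y := fun z t => Y z (-t))
      (fun z hz => (hF z hz).neg) (fun z hz => by simpa using hY0 z hz)
      (fun z hz => (hY z hz).reverse) 1).mono (prod_mono_right hηD)
  have hSD : S ⊆ D := by
    rintro _ ⟨⟨t, w⟩, ⟨-, hw⟩, rfl⟩
    exact (hY w (hηD hw) (-t)).1
  have hzero : ∀ z, z ∉ S → χ z = 0 := fun z hz => by
    by_cases hzD : z ∈ D
    · rw [hχD z hzD]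
      have : ∀ t ∈ uIcc (0 : ℝ) 1, η (Y z t) = 0 := fun t ht => by
        by_contra hne
        refine hz ⟨(t, Y z t), ⟨by rwa [uIcc_of_le zero_le_one] at ht,
          subset_tsupport _ hne⟩, ?_⟩
        have hw : Y z t ∈ D := (hY z hzD t).1
        have := (hY _ hw).eq hF ((hY z hzD).shift t) (by simp [hY0 _ hw]) (-t)
        simpa [hY0 z hzD] using this
      rw [intervalIntegral.integral_congr (g := fun _ => (0 : ℝ)) this]
      simp
    · exact if_neg hzD
  have hsupp : tsupport χ ⊆ S :=
    closure_minimal (fun z hz => by_contra fun h => hz (hzero z h)) hSc.isClosed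
  have hχc : HasCompactSupport χ := hSc.of_isClosed_subset (isClosed_tsupport χ) hsupp
  have hloc : LocallyLipschitz χ := by
    intro z₀
    by_cases hz₀ : z₀ ∈ S
    · have hz₀D := hSD hz₀
      obtain ⟨δ, hδ, L, hL0, hL⟩ := (hY z₀ hz₀D).exists_bound hF 1
      refine ⟨M * L.toNNReal, D ∩ Metric.ball z₀ δ,
        inter_mem (hD.mem_nhds hz₀D) (Metric.ball_mem_nhds z₀ hδ),
        LipschitzOnWith.of_dist_le_mul fun z hz z' hz' => ?_⟩
      rw [hχD z hz.1, hχD z' hz'.1, dist_eq_norm, ← intervalIntegral.integral_sub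
        ((hcont z hz.1).intervalIntegrable _ _) ((hcont z' hz'.1).intervalIntegrable _ _)]
      have hb : ∀ t ∈ uIoc (0 : ℝ) 1, ‖η (Y z t) - η (Y z' t)‖ ≤ M * (L * dist z z') :=
        fun t ht => by
          rw [uIoc_of_le zero_le_one] at ht
          have e := hL (Y z) (Y z') (hY z hz.1) (hY z' hz'.1)
            (by rw [hY0 z hz.1, hY0 z₀ hz₀D]; exact hz.2)
            (by rw [hY0 z' hz'.1, hY0 z₀ hz₀D]; exact hz'.2) t ⟨ht.1.le, ht.2⟩
          rw [hY0 z hz.1, hY0 z' hz'.1] at e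
          rw [← dist_eq_norm]
          exact (hη.dist_le_mul _ _).trans (mul_le_mul_of_nonneg_left e M.coe_nonneg)
      have := intervalIntegral.norm_integral_le_of_norm_le_const hb
      rw [sub_zero, abs_one, mul_one] at this
      push_cast
      rw [Real.coe_toNNReal L hL0, mul_assoc]
      exact this
    · refine ⟨0, Sᶜ, hSc.isClosed.isOpen_compl.mem_nhds hz₀, ?_⟩
      refine LipschitzOnWith.of_dist_le_mul fun z hz z' hz' => ?_
      simp [hzero z hz, hzero z' hz']
  refine ⟨χ, exists_lipschitzWith_of_locallyLipschitz hloc hχc, hχc, hsupp.trans hSD, hχD,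
    fun z hz hd => ?_⟩
  set g : ℝ → ℝ := fun t => η (Y z t) with hg
  have hgc : Continuous g := hcont z hz
  have h1 : HasDerivAt (fun s => χ (Y z s)) (fderiv ℝ χ z (F z)) 0 := by
    have hd' : HasFDerivAt χ (fderiv ℝ χ z) (Y z 0) := by rw [hY0 z hz]; exact hd.hasFDerivAt
    have := hd'.comp_hasDerivAt (0 : ℝ) (hY z hz 0).2
    rwa [hY0 z hz] at this
  -- By the group property, χ along an orbit is the integral of g over the window [s, s + 1], so its
  -- derivative at s = 0 is g 1 - g 0 even though η is not differentiated.
  have h2 : (fun s => χ (Y z s)) = fun s => (∫ t in (0 : ℝ)..(1 + s), g t) - ∫ t in (0 : ℝ)..s, g t := by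
    ext s
    have hw : Y z s ∈ D := (hY z hz s).1
    rw [hχD _ hw]
    have e : ∀ t, η (Y (Y z s) t) = g (t + s) := fun t => by
      rw [hg, (hY _ hw).eq hF ((hY z hz).shift s) (by simp [hY0 _ hw]) t]
    simp only [e]
    rw [intervalIntegral.integral_comp_add_right, zero_add,
      intervalIntegral.integral_interval_sub_left (hgc.intervalIntegrable _ _)
        (hgc.intervalIntegrable _ _)]
  have h3 : HasDerivAt (fun s => (∫ t in (0 : ℝ)..(1 + s), g t) - ∫ t in (0 : ℝ)..s, g t)
      (g 1 - g 0) 0 := by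
    have ha := (intervalIntegral.integral_hasDerivAt_right (hgc.intervalIntegrable 0 (1 + 0))
      (hgc.stronglyMeasurableAtFilter _ _) hgc.continuousAt).comp_const_add 1 0
    have hb := intervalIntegral.integral_hasDerivAt_right (hgc.intervalIntegrable 0 0)
      (hgc.stronglyMeasurableAtFilter _ _) hgc.continuousAt
    simp only [add_zero] at ha
    exact ha.sub hb
  rw [h2] at h1
  rw [h1.unique h3, hg]
  simp only [hY0 z hz]

end Flow

/-! ### Cutoffs adapted to the flow -/

section FlowCutoff

variable {n : ℕ} {D : Set (Phase n)} {F : Phase n → Phase n}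

/-- An exhausting sequence of cutoff functions. -/
theorem exists_cutoff_sequence (hD : IsOpen D) :
    ∃ η : ℕ → Phase n → ℝ, (∀ k, ContDiff ℝ ∞ (η k) ∧ HasCompactSupport (η k) ∧
      tsupport (η k) ⊆ D ∧ ∀ z, η k z ∈ Icc (0 : ℝ) 1) ∧
      ∀ C : Set (Phase n), IsCompact C → C ⊆ D → ∀ᶠ k in atTop, ∀ z ∈ C, η k z = 1 := by
  -- Exhaustion of D by points of norm at most k and at distance at least 1/(k+1) from the
  -- complement of D.
  set K : ℕ → Set (Phase n) := fun k =>
    Metric.closedBall 0 k ∩ (Metric.thickening (1 / ((k : ℝ) + 1)) Dᶜ)ᶜ with hK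
  have hKc : ∀ k, IsCompact (K k) := fun k =>
    (isCompact_closedBall _ _).inter_right Metric.isOpen_thickening.isClosed_compl
  have hKD : ∀ k, K k ⊆ D := fun k z hz => by
    by_contra h
    exact hz.2 (Metric.self_subset_thickening (by positivity) _ h)
  choose η hη using fun k => exists_smooth_cutoff hD (hKc k) (hKD k)
  refine ⟨η, fun k => ⟨(hη k).1, (hη k).2.1, (hη k).2.2.1, (hη k).2.2.2.2⟩, fun C hC hCD => ?_⟩
  obtain ⟨δ, hδ, hCδ⟩ := hC.exists_cthickening_subset_open hD hCD
  obtain ⟨R, hR⟩ := hC.isBounded.subset_closedBall (0 : Phase n)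
  filter_upwards [tendsto_one_div_add_atTop_nhds_zero_nat.eventually_lt_const hδ,
    tendsto_natCast_atTop_atTop.eventually_ge_atTop R] with k hk hkR z hz
  refine (hη k).2.2.2.1.self_of_nhdsSet z ⟨Metric.closedBall_subset_closedBall hkR (hR hz),
    fun hth => ?_⟩
  obtain ⟨y, hy, hyz⟩ := Metric.mem_thickening_iff.1 hth
  exact hy (hCδ (Metric.mem_cthickening_of_dist_le y z δ C hz
    (by rw [dist_comm]; exact (hyz.trans hk).le)))

/-- On a flow invariant region there are cutoff functions whose derivative along the flow is
bounded and tends to zero. -/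
theorem exists_flow_cutoff_sequence (hD : IsOpen D) (hF : ∀ z ∈ D, ContDiffAt ℝ 1 F z)
    (hsol : ∀ z ∈ D, ∃ y : ℝ → Phase n, y 0 = z ∧ IsOrbit F D y) :
    ∃ χ : ℕ → Phase n → ℝ, (∀ k, (∃ C, LipschitzWith C (χ k)) ∧ HasCompactSupport (χ k) ∧
        tsupport (χ k) ⊆ D) ∧
      (∀ k, ∀ z ∈ D, ‖χ k z‖ ≤ 1 ∧ ‖fderiv ℝ (χ k) z (F z)‖ ≤ 1) ∧
      ∀ z ∈ D, ∀ᶠ k in atTop, χ k z = 1 ∧ fderiv ℝ (χ k) z (F z) = 0 := by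
  choose! Y hY0 hY using hsol
  obtain ⟨η, hη, hη1⟩ := exists_cutoff_sequence hD
  have hLip : ∀ k, ∃ M, LipschitzWith M (η k) := fun k =>
    (hη k).1.lipschitzWith_of_hasCompactSupport (hη k).2.1 (by simp)
  choose M hM using hLip
  choose χ hL hc hsub hχ hd using fun k =>
    exists_flow_average hD hF hY0 hY (hM k) (hη k).2.1 (hη k).2.2.1
  refine ⟨χ, fun k => ⟨hL k, hc k, hsub k⟩, fun k z hz => ⟨?_, ?_⟩, fun z hz => ?_⟩
  · rw [hχ k z hz]
    have := intervalIntegral.norm_integral_le_of_norm_le_const (a := (0 : ℝ)) (b := 1) (C := 1)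
      (f := fun t => η k (Y z t)) fun t _ => by
        have := (hη k).2.2.2 (Y z t)
        rw [Real.norm_of_nonneg this.1]; exact this.2
    simpa using this
  -- Where χ k is not differentiable, `fderiv` takes the default value 0, so the bound holds there
  -- as well.
  · by_cases hdf : DifferentiableAt ℝ (χ k) z
    · rw [hd k z hz hdf, Real.norm_eq_abs, abs_le]
      have h1 := (hη k).2.2.2 (Y z 1)
      have h2 := (hη k).2.2.2 z
      constructor <;> linarith [h1.1, h1.2, h2.1, h2.2]
    · simp [fderiv_zero_of_not_differentiableAt hdf]
  -- The orbit segment over unit time is compact in D, so eventually the cutoff is 1 on all of it: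
  -- the average is then 1 and the endpoint difference 0.
  · have hcomp : IsCompact (Y z '' Icc (0 : ℝ) 1) :=
      isCompact_Icc.image (hY z hz).continuous
    have hsubD : Y z '' Icc (0 : ℝ) 1 ⊆ D := by
      rintro _ ⟨t, -, rfl⟩
      exact (hY z hz t).1
    filter_upwards [hη1 _ hcomp hsubD] with k hk
    have hk' : ∀ t ∈ Icc (0 : ℝ) 1, η k (Y z t) = 1 := fun t ht => hk _ (mem_image_of_mem _ ht)
    constructor
    · rw [hχ k z hz, intervalIntegral.integral_congr (g := fun _ => (1 : ℝ)) fun t ht =>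
        hk' t (by rwa [uIcc_of_le zero_le_one] at ht)]
      simp
    · by_cases hdf : DifferentiableAt ℝ (χ k) z
      · have h0 := hk' 0 ⟨le_rfl, zero_le_one⟩
        rw [hY0 z hz] at h0
        rw [hd k z hz hdf, hk' 1 ⟨zero_le_one, le_rfl⟩, h0, sub_self]
      · simp [fderiv_zero_of_not_differentiableAt hdf]

end FlowCutoff

end PontryaginKoopman

end

noncomputable section

namespace PontryaginKoopman

open Filter Topology Set Convolution ContinuousLinearMap
open scoped NNReal

/-! ### Pontryagin's field is the Hamiltonian field of the minimized Hamiltonian -/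

section Hamiltonian

variable {n m : ℕ}

/-- The state part as a continuous linear map. -/
def stateL (n : ℕ) : Phase n →L[ℝ] EuclideanSpace ℝ (Fin n) :=
  LinearMap.toContinuousLinearMap
    { toFun := stateOf
      map_add' := fun _ _ => rfl
      map_smul' := fun _ _ => rfl }

/-- The co-state part as a continuous linear map. -/
def costateL (n : ℕ) : Phase n →L[ℝ] EuclideanSpace ℝ (Fin n) :=
  LinearMap.toContinuousLinearMap
    { toFun := costateOf
      map_add' := fun _ _ => rfl
      map_smul' := fun _ _ => rfl }

theorem stateOf_basisVec_inl (i : Fin n) :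
    stateOf (basisVec (Sum.inl i) : Phase n) = EuclideanSpace.single i 1 := by
  ext j
  simp [stateOf, basisVec]

theorem stateOf_basisVec_inr (i : Fin n) : stateOf (basisVec (Sum.inr i) : Phase n) = 0 := by
  ext j
  simp [stateOf, basisVec]

theorem costateOf_basisVec_inr (i : Fin n) :
    costateOf (basisVec (Sum.inr i) : Phase n) = EuclideanSpace.single i 1 := by
  ext j
  simp [costateOf, basisVec]

theorem costateOf_basisVec_inl (i : Fin n) : costateOf (basisVec (Sum.inl i) : Phase n) = 0 := by
  ext j
  simp [costateOf, basisVec]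

variable (f : EuclideanSpace ℝ (Fin n) → EuclideanSpace ℝ (Fin m) → EuclideanSpace ℝ (Fin n))
  (l : EuclideanSpace ℝ (Fin n) → EuclideanSpace ℝ (Fin m) → ℝ)
  (us : EuclideanSpace ℝ (Fin n) → EuclideanSpace ℝ (Fin n) → EuclideanSpace ℝ (Fin m))

/-- The Hamiltonian as a function on the product of phase space and control space. -/
def jointHam (p : Phase n × EuclideanSpace ℝ (Fin m)) : ℝ :=
  hamiltonian f l (stateOf p.1) p.2 (costateOf p.1)

/-- The minimizing control as a function on phase space. -/
def optControl (z : Phase n) : EuclideanSpace ℝ (Fin m) := us (stateOf z) (costateOf z)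

/-- The minimized Hamiltonian. -/
def optHam (z : Phase n) : ℝ := jointHam f l (z, optControl us z)

/-- The derivative of the Hamiltonian in the control. -/
def controlDeriv (p : Phase n × EuclideanSpace ℝ (Fin m)) : EuclideanSpace ℝ (Fin m) →L[ℝ] ℝ :=
  fderiv ℝ (jointHam f l) p ∘L .inr ℝ (Phase n) (EuclideanSpace ℝ (Fin m))

variable {f l us}

theorem contDiff_jointHam (hf : DynamicsAssumption f) (hl : CostAssumption l) :
    ContDiff ℝ 2 (jointHam f l) := by
  have hs : ContDiff ℝ 2 fun p : Phase n × EuclideanSpace ℝ (Fin m) => (stateL n p.1, p.2) :=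
    ((stateL n).contDiff.comp contDiff_fst).prodMk contDiff_snd
  have hc : ContDiff ℝ 2 fun p : Phase n × EuclideanSpace ℝ (Fin m) => costateL n p.1 :=
    (costateL n).contDiff.comp contDiff_fst
  exact (hc.inner ℝ (hf.contDiff.comp hs)).add (ContDiff.comp hl hs)

theorem contDiff_controlDeriv (hf : DynamicsAssumption f) (hl : CostAssumption l) :
    ContDiff ℝ 1 (controlDeriv f l) :=
  ((contDiff_jointHam hf hl).fderiv_right (m := 1) (by norm_num)).clm_comp contDiff_const

theorem controlDeriv_eq (hf : DynamicsAssumption f) (hl : CostAssumption l) (z : Phase n)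
    (u : EuclideanSpace ℝ (Fin m)) :
    fderiv ℝ (fun w => hamiltonian f l (stateOf z) w (costateOf z)) u =
      controlDeriv f l (z, u) :=
  (((contDiff_jointHam hf hl).differentiable (by norm_num) (z, u)).hasFDerivAt.comp u
    (hasFDerivAt_prodMk_right z u)).fderiv

theorem controlDeriv_optControl (hf : DynamicsAssumption f) (hl : CostAssumption l)
    (hu : MinimizerAssumption f l us) (z : Phase n) :
    controlDeriv f l (z, optControl us z) = 0 := by
  rw [← controlDeriv_eq hf hl]
  exact IsLocalMin.fderiv_eq_zero (Eventually.of_forall fun w => hu.isMin _ _ w)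

/-- A positive definite form is injective as a map into the dual space, which has the same finite
dimension. -/
theorem isInvertible_controlHessian (hf : DynamicsAssumption f) (hl : CostAssumption l)
    (hu : MinimizerAssumption f l us) (z : Phase n) :
    (fderiv ℝ (controlDeriv f l) (z, optControl us z) ∘L
      .inr ℝ (Phase n) (EuclideanSpace ℝ (Fin m))).IsInvertible := by
  set T := fderiv ℝ (controlDeriv f l) (z, optControl us z) ∘L
    .inr ℝ (Phase n) (EuclideanSpace ℝ (Fin m)) with hT
  have hTeq : fderiv ℝ (fun u => fderiv ℝ
      (fun w => hamiltonian f l (stateOf z) w (costateOf z)) u) (optControl us z) = T := by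
    simp only [controlDeriv_eq hf hl]
    exact (((contDiff_controlDeriv hf hl).differentiable (by norm_num)
      (z, optControl us z)).hasFDerivAt.comp _ (hasFDerivAt_prodMk_right z _)).fderiv
  have hpos : ∀ v, v ≠ 0 → 0 < T v v := fun v hv => by
    rw [← hTeq]
    exact hu.hessian_pos _ _ v hv
  have hinj : Function.Injective T.toLinearMap := by
    rw [← LinearMap.ker_eq_bot, LinearMap.ker_eq_bot']
    intro v hv
    by_contra hne
    have h0 : T v = 0 := hv
    have := hpos v hne
    rw [h0] at this
    exact lt_irrefl _ this
  have hdim : Module.finrank ℝ (EuclideanSpace ℝ (Fin m)) =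
      Module.finrank ℝ (EuclideanSpace ℝ (Fin m) →L[ℝ] ℝ) :=
    (InnerProductSpace.toDual ℝ (EuclideanSpace ℝ (Fin m))).toLinearEquiv.finrank_eq
  refine ⟨(T.toLinearMap.linearEquivOfInjective hinj
    hdim).toContinuousLinearEquiv, ?_⟩
  ext v
  rfl

variable {D : Set (Phase n)}

/-- The minimizer solves H_u = 0. Its continuity keeps it in the neighbourhood where the implicit
function is the only solution, so the two agree locally. -/
theorem contDiffAt_optControl (hf : DynamicsAssumption f) (hl : CostAssumption l)
    (hu : MinimizerAssumption f l us) (hD : IsOpen D) (hc : ContinuousOn (optControl us) D)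
    {z : Phase n} (hz : z ∈ D) : ContDiffAt ℝ 1 (optControl us) z := by
  have hC : ContDiffAt ℝ 1 (controlDeriv f l) (z, optControl us z) :=
    (contDiff_controlDeriv hf hl).contDiffAt
  have hinv := isInvertible_controlHessian hf hl hu z
  refine (hC.contDiffAt_implicitFunction one_ne_zero hinv).congr_of_eventuallyEq ?_
  have hcz : ContinuousAt (fun y => (y, optControl us y)) z :=
    continuousAt_id.prodMk (hc.continuousAt (hD.mem_nhds hz))
  filter_upwards [hcz.eventually (hC.eventually_apply_eq_iff_implicitFunction one_ne_zero hinv)]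
    with y hy
  exact (hy.1 (by rw [controlDeriv_optControl hf hl hu, controlDeriv_optControl hf hl hu])).symm

/-- The envelope theorem. -/
theorem hasFDerivAt_optHam (hf : DynamicsAssumption f) (hl : CostAssumption l)
    (hu : MinimizerAssumption f l us) (hD : IsOpen D) (hc : ContinuousOn (optControl us) D)
    {z : Phase n} (hz : z ∈ D) :
    HasFDerivAt (optHam f l us) (fderiv ℝ (jointHam f l) (z, optControl us z) ∘L
      .inl ℝ (Phase n) (EuclideanSpace ℝ (Fin m))) z := by
  have h1 : HasFDerivAt (optControl us) _ z :=
    ((contDiffAt_optControl hf hl hu hD hc hz).differentiableAt (by simp)).hasFDerivAt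
  have h2 := ((contDiff_jointHam hf hl).differentiable (by norm_num)
    (z, optControl us z)).hasFDerivAt.comp z ((hasFDerivAt_id z).prodMk h1)
  convert! h2 using 1
  ext v
  have h0 := controlDeriv_optControl hf hl hu z
  -- Stationarity in the control removes the chain-rule term that contains the derivative of the
  -- minimizer.
  have h0v : fderiv ℝ (jointHam f l) (z, optControl us z)
      (0, fderiv ℝ (optControl us) z v) = 0 := congrArg (fun T => T (fderiv ℝ (optControl us) z v)) h0
  have hsum : (v, fderiv ℝ (optControl us) z v) =
      ((v, 0) : Phase n × EuclideanSpace ℝ (Fin m)) + (0, fderiv ℝ (optControl us) z v) := by simp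
  change fderiv ℝ (jointHam f l) (z, optControl us z) (v, 0) =
    fderiv ℝ (jointHam f l) (z, optControl us z) (v, fderiv ℝ (optControl us) z v)
  rw [hsum, map_add, h0v, add_zero]

/-- One order is gained over the minimizer: the envelope formula for the derivative contains the
minimizer but not its derivative, so it is C¹. -/
theorem contDiffAt_optHam (hf : DynamicsAssumption f) (hl : CostAssumption l)
    (hu : MinimizerAssumption f l us) (hD : IsOpen D) (hc : ContinuousOn (optControl us) D)
    {z : Phase n} (hz : z ∈ D) : ContDiffAt ℝ 2 (optHam f l us) z := by
  have h : ContDiffAt ℝ ((1 : ℕ) + 1) (optHam f l us) z := by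
    rw [contDiffAt_succ_iff_hasFDerivAt]
    refine ⟨_, ⟨D, hD.mem_nhds hz, fun y hy => hasFDerivAt_optHam hf hl hu hD hc hy⟩, ?_⟩
    refine ContDiffAt.clm_comp ?_ contDiffAt_const
    have h1 : ContDiff ℝ 1 (fderiv ℝ (jointHam f l)) :=
      (contDiff_jointHam hf hl).fderiv_right (by norm_num)
    exact h1.contDiffAt.comp z
      (contDiffAt_id.prodMk (contDiffAt_optControl hf hl hu hD hc hz))
  convert! h using 1

/-- By the envelope theorem the derivatives of the minimized Hamiltonian may be computed with the
control frozen. The co-state directions then give f, since H is affine in the co-state, and the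
state directions give ∇ₓH. -/
theorem pontryaginField_eq_hamComp (hf : DynamicsAssumption f) (hl : CostAssumption l)
    (hu : MinimizerAssumption f l us) (hD : IsOpen D) (hc : ContinuousOn (optControl us) D)
    {z : Phase n} (hz : z ∈ D) (i : Fin n ⊕ Fin n) :
    pontryaginField f l us z i = hamComp (optHam f l us) i z := by
  set u := optControl us z with hu'
  have hder : ∀ v : Phase n, HasDerivAt (fun t : ℝ => jointHam f l (z + t • v, u))
      (fderiv ℝ (optHam f l us) z v) 0 := fun v => by
    rw [(hasFDerivAt_optHam hf hl hu hD hc hz).fderiv]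
    have h1 : HasFDerivAt (fun y => jointHam f l (y, u)) (fderiv ℝ (jointHam f l) (z, u) ∘L
        .inl ℝ (Phase n) (EuclideanSpace ℝ (Fin m))) z :=
      HasFDerivAt.comp (g := jointHam f l) (f := fun y => (y, u)) z
        ((contDiff_jointHam hf hl).differentiable (by norm_num) (z, u)).hasFDerivAt
        (hasFDerivAt_prodMk_left z u)
    exact h1.hasLineDerivAt v
  have hst : ∀ (t : ℝ) (v : Phase n), stateOf (z + t • v) = stateOf z + t • stateOf v :=
    fun _ _ => rfl
  have hcost : ∀ (t : ℝ) (v : Phase n), costateOf (z + t • v) = costateOf z + t • costateOf v :=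
    fun _ _ => rfl
  rcases i with i | i
  · have h1 := hder (basisVec (Sum.inr i))
    have h2 : HasDerivAt (fun t : ℝ => jointHam f l (z + t • basisVec (Sum.inr i), u))
        (f (stateOf z) u i) 0 := by
      have e : (fun t : ℝ => jointHam f l (z + t • basisVec (Sum.inr i), u)) =
          fun t => t * f (stateOf z) u i + jointHam f l (z, u) := by
        ext t
        simp only [jointHam, hamiltonian, hst, hcost, stateOf_basisVec_inr, costateOf_basisVec_inr,
          smul_zero, add_zero, inner_add_left, inner_smul_left, EuclideanSpace.inner_single_left]
        simp
        ring
      rw [e]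
      simpa using ((hasDerivAt_id (0 : ℝ)).mul_const (f (stateOf z) u i)).add_const
        (jointHam f l (z, u))
    change f (stateOf z) u i = coordSign (Sum.inl i) * partialD (optHam f l us) (Sum.inr i) z
    rw [partialD, h1.unique h2]
    simp [coordSign]
  · have h1 := hder (basisVec (Sum.inl i))
    set g : EuclideanSpace ℝ (Fin n) → ℝ := fun ξ => hamiltonian f l ξ u (costateOf z) with hg
    have hgd : DifferentiableAt ℝ g (stateOf z) := by
      have hp : ContDiff ℝ 2 fun ξ : EuclideanSpace ℝ (Fin n) => (ξ, u) :=
        contDiff_id.prodMk contDiff_const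
      have : ContDiff ℝ 2 g :=
        (contDiff_const.inner ℝ (hf.contDiff.comp hp)).add (ContDiff.comp hl hp)
      exact this.differentiable (by norm_num) _
    have h2 : HasDerivAt (fun t : ℝ => jointHam f l (z + t • basisVec (Sum.inl i), u))
        (gradient g (stateOf z) i) 0 := by
      have e : (fun t : ℝ => jointHam f l (z + t • basisVec (Sum.inl i), u)) =
          fun t => g (stateOf z + t • EuclideanSpace.single i 1) := by
        ext t
        simp only [jointHam, hg, hst, hcost, stateOf_basisVec_inl, costateOf_basisVec_inl,
          smul_zero, add_zero]
      rw [e]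
      have h3 := hgd.hasFDerivAt.hasLineDerivAt (EuclideanSpace.single i 1)
      have h4 : fderiv ℝ g (stateOf z) (EuclideanSpace.single i 1) = gradient g (stateOf z) i := by
        rw [← toDual_gradient, InnerProductSpace.toDual_apply_apply,
          EuclideanSpace.inner_single_right]
        simp
      rw [h4] at h3
      exact h3
    change -(gradient g (stateOf z) i) =
      coordSign (Sum.inr i) * partialD (optHam f l us) (Sum.inl i) z
    rw [partialD, h1.unique h2]
    simp [coordSign]

theorem hamVec_apply (b : Phase n → ℝ) (z : Phase n) (i : Fin n ⊕ Fin n) :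
    hamVec b z i = hamComp b i z := by
  rcases i with i | i <;> simp [hamVec, hamComp, basisVec, Pi.single_apply]

theorem pontryaginField_eq_hamVec (hf : DynamicsAssumption f) (hl : CostAssumption l)
    (hu : MinimizerAssumption f l us) (hD : IsOpen D) (hc : ContinuousOn (optControl us) D)
    {z : Phase n} (hz : z ∈ D) : pontryaginField f l us z = hamVec (optHam f l us) z := by
  ext i
  rw [hamVec_apply, pontryaginField_eq_hamComp hf hl hu hD hc hz]

theorem contDiffAt_pontryaginField (hf : DynamicsAssumption f) (hl : CostAssumption l)
    (hu : MinimizerAssumption f l us) (hD : IsOpen D) (hc : ContinuousOn (optControl us) D)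
    {z : Phase n} (hz : z ∈ D) : ContDiffAt ℝ 1 (pontryaginField f l us) z := by
  rw [contDiffAt_euclidean]
  intro i
  have h : ContDiffAt ℝ 1 (hamComp (optHam f l us) i) z :=
    contDiffAt_const.mul (contDiffAt_partialD (contDiffAt_optHam hf hl hu hD hc hz) i.swap)
  refine h.congr_of_eventuallyEq ?_
  filter_upwards [hD.mem_nhds hz] with y hy
  exact pontryaginField_eq_hamComp hf hl hu hD hc hy i

end Hamiltonian

end PontryaginKoopman

end

noncomputable section

namespace PontryaginKoopman

open Filter Topology Set Convolution ContinuousLinearMap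
open scoped NNReal

/-! ### Skew-orthogonality of eigenfunctions -/

section Orthogonality

variable {n m : ℕ} {D : Set (Phase n)}

/-- The spectral decomposition is weak, so ω(φ, ·) has to be a continuous functional. It is a sum of
L² inner products; conjugating the gradient of φ offsets the conjugation in the inner product. -/
theorem exists_omega_functional (φ : W12 D) :
    ∃ ℓ : W12 D →L[ℂ] ℂ, ∀ ψ, ℓ ψ = omega φ ψ := by
  refine ⟨∑ i, (coordSign i : ℂ) • ((innerSL ℂ (star (gradOf φ i))) ∘L
    ((ContinuousLinearMap.proj (R := ℂ) (φ := fun _ : Fin n ⊕ Fin n => L2 D) i.swap) ∘L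
      (ContinuousLinearMap.snd ℂ (L2 D) (Fin n ⊕ Fin n → L2 D)) ∘L (W12 D).subtypeL)),
    fun ψ => ?_⟩
  have hint : ∀ i ∈ (Finset.univ : Finset (Fin n ⊕ Fin n)), Integrable
      (fun z => (coordSign i : ℂ) * gradOf φ i z * gradOf ψ i.swap z) (volume.restrict D) :=
    fun i _ => by
      have h : Integrable (fun z => gradOf φ i z * gradOf ψ i.swap z) (volume.restrict D) :=
        memLp_one_iff_integrable.1 ((Lp.memLp (gradOf ψ i.swap)).mul' (Lp.memLp (gradOf φ i)))
      simpa only [mul_assoc] using h.const_mul (coordSign i : ℂ)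
  rw [omega_eq_integral_weakPoisson]
  simp only [weakPoisson]
  rw [integral_finsetSum _ hint, _root_.sum_apply]
  refine Finset.sum_congr rfl fun i _ => ?_
  change (coordSign i : ℂ) * inner ℂ (star (gradOf φ i)) (gradOf ψ i.swap) = _
  rw [L2.inner_def, ← integral_const_mul]
  refine integral_congr_ae ?_
  filter_upwards [Lp.coeFn_star (gradOf φ i)] with z hz
  rw [hz, RCLike.inner_apply]
  simp
  ring

/-- This rules out that the eigenvalue 0 serves as its own mirror image. -/
theorem omega_self (φ : W12 D) : omega φ φ = 0 :=
  self_eq_neg.1 (omega_antisymm φ φ)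

/-- On the whole phase space, `ω` vanishes identically. -/
theorem omega_eq_zero_of_univ (φ ψ : W12 (univ : Set (Phase n))) : omega φ ψ = 0 := by
  obtain ⟨η, hη, hηc, -, hη1, hη01⟩ := exists_smooth_cutoff (isOpen_univ (X := Phase n))
    (isCompact_singleton (x := (0 : Phase n))) (subset_univ _)
  rw [nhdsSet_singleton] at hη1
  obtain ⟨C, hC⟩ := exists_lipschitzWith_of_locallyLipschitz
    ((hη.of_le (by simp) : ContDiff ℝ 1 η).locallyLipschitz) hηc
  set r : ℕ → ℝ≥0 := fun k => ((k : ℝ≥0) + 1)⁻¹ with hr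
  have hr0 : ∀ k, r k ≠ 0 := fun k => by positivity
  have hrlim : Tendsto (fun k => (r k : ℝ)) atTop (𝓝 0) := by
    simpa [hr, one_div] using tendsto_one_div_add_atTop_nhds_zero_nat (𝕜 := ℝ)
  -- Dilated cutoffs have Lipschitz constant C/(k+1), so after integration by parts the integral of
  -- χ {φ, ψ} is O(1/k).
  set χ : ℕ → Phase n → ℝ := fun k z => η ((r k : ℝ) • z) with hχ
  have hLip : ∀ k, LipschitzWith (C * r k) (χ k) := fun k => by
    refine hC.comp (LipschitzWith.of_dist_le_mul fun x y => ?_)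
    rw [dist_smul₀, Real.norm_of_nonneg (r k).coe_nonneg]
  have hsupp : ∀ k, HasCompactSupport (χ k) := fun k =>
    hηc.comp_homeomorph (Homeomorph.smulOfNeZero (r k : ℝ) (by simpa using hr0 k))
  have hparts := fun k => integral_weakPoisson_parts isOpen_univ (hLip k) (hsupp k)
    (subset_univ _) φ ψ
  set G : Phase n → ℝ := fun z => ∑ i, ‖fnOf φ z * gradOf ψ i z‖ with hG
  have hGi : Integrable G (volume.restrict univ) :=
    integrable_finsetSum _ fun i _ => (memLp_one_iff_integrable.1
      ((Lp.memLp (gradOf ψ i)).mul' (Lp.memLp (fnOf φ)))).norm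
  have hR : Tendsto (fun k => ∫ z in univ, fnOf φ z * weakLie (χ k) ψ z) atTop (𝓝 0) := by
    refine squeeze_zero_norm (a := fun k => (C * r k : ℝ) * ∫ z in univ, G z) (fun k => ?_) ?_
    · rw [← integral_const_mul]
      refine norm_integral_le_of_norm_le (hGi.const_mul _) (Eventually.of_forall fun z => ?_)
      rw [weakLie, Finset.mul_sum, hG, Finset.mul_sum]
      refine norm_sum_le_of_le _ fun i _ => ?_
      have h1 : ‖((hamComp (χ k) i z : ℝ) : ℂ)‖ ≤ C * r k := by
        rw [Complex.norm_real, hamComp, norm_mul, abs_coordSign, one_mul]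
        simpa using abs_partialD_le (hLip k) i.swap z
      rw [mul_left_comm, norm_mul]
      exact mul_le_mul_of_nonneg_right h1 (norm_nonneg _)
    · simpa using (hrlim.const_mul (C : ℝ)).mul_const (∫ z in univ, G z)
  have hLlim : Tendsto (fun k => ∫ z in univ, (χ k z : ℂ) * weakPoisson φ ψ z) atTop
      (𝓝 (∫ z in univ, weakPoisson φ ψ z)) := by
    refine tendsto_integral_of_dominated_convergence (fun z => ‖weakPoisson φ ψ z‖)
      (fun k => (Complex.continuous_ofReal.comp (hLip k).continuous).aestronglyMeasurable.mul
        (integrable_weakPoisson φ ψ).aestronglyMeasurable)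
      (integrable_weakPoisson φ ψ).norm (fun k => Eventually.of_forall fun z => ?_)
      (Eventually.of_forall fun z => ?_)
    · rw [norm_mul, Complex.norm_real]
      refine mul_le_of_le_one_left (norm_nonneg _) ?_
      rw [Real.norm_of_nonneg (hη01 _).1]
      exact (hη01 _).2
    · refine tendsto_const_nhds.congr' ?_
      have hz : Tendsto (fun k => (r k : ℝ) • z) atTop (𝓝 0) := by
        simpa using hrlim.smul_const z
      filter_upwards [hz.eventually hη1] with k hk
      rw [hχ]
      simp only [hk, Complex.ofReal_one, one_mul]
  rw [omega_eq_integral_weakPoisson]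
  simp only [hparts] at hLlim
  exact tendsto_nhds_unique hLlim hR

variable {f : EuclideanSpace ℝ (Fin n) → EuclideanSpace ℝ (Fin m) → EuclideanSpace ℝ (Fin n)}
  {l : EuclideanSpace ℝ (Fin n) → EuclideanSpace ℝ (Fin m) → ℝ}
  {us : EuclideanSpace ℝ (Fin n) → EuclideanSpace ℝ (Fin n) → EuclideanSpace ℝ (Fin m)}

/-- On an invariant region, eigenfunctions of `L` are skew-orthogonal unless their eigenvalues are
mirrored. -/
theorem omega_eq_zero_of_invariant (hf : DynamicsAssumption f) (hl : CostAssumption l)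
    (hu : MinimizerAssumption f l us) (hD : IsOpen D) (hc : ContinuousOn (optControl us) D)
    (hsol : ∀ z ∈ D, ∃ y : ℝ → Phase n, y 0 = z ∧ IsOrbit (pontryaginField f l us) D y)
    {κ μ : ℂ} {φ ψ : W12 D} (hφ : IsEigenfunction (pontryaginField f l us) D κ φ)
    (hψ : IsEigenfunction (pontryaginField f l us) D μ ψ) (hne : κ + μ ≠ 0) :
    omega φ ψ = 0 := by
  set F := pontryaginField f l us with hF
  set h := optHam f l us with hh
  have hh2 : ∀ z ∈ D, ContDiffAt ℝ 2 h z := fun z hz => contDiffAt_optHam hf hl hu hD hc hz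
  have hlie : ∀ {ν : ℂ} {θ : W12 D}, IsEigenfunction F D ν θ →
      ∀ᵐ z ∂(volume.restrict D), weakLie h θ z = ν * fnOf θ z := fun {ν θ} hθ => by
    filter_upwards [hθ.eigen, ae_restrict_mem hD.measurableSet] with z hz hzD
    rw [← hz, weakLie]
    simp only [hF, hh, pontryaginField_eq_hamComp hf hl hu hD hc hzD]
  obtain ⟨χ, hχ, hχb, hχlim⟩ := exists_flow_cutoff_sequence hD
    (fun z hz => contDiffAt_pontryaginField hf hl hu hD hc hz) hsol
  -- The bracket with h is the derivative along the flow, which for these cutoffs is bounded by 1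
  -- and tends to 0. Dominated convergence then applies to both sides of `hkey`, with majorant |{φ,
  -- ψ}|.
  have hpois : ∀ k, ∀ z ∈ D, poisson (χ k) h z = fderiv ℝ (χ k) z (F z) := fun k z hz => by
    rw [poisson_eq, hF, pontryaginField_eq_hamVec hf hl hu hD hc hz]
  have hkey : ∀ k, (κ + μ) * ∫ z in D, (χ k z : ℂ) * weakPoisson φ ψ z =
      -∫ z in D, weakPoisson φ ψ z * (poisson (χ k) h z : ℂ) := fun k => by
    obtain ⟨⟨C, hC⟩, hcs, hsub⟩ := hχ k
    exact eigen_integral_weakPoisson hD hC hcs hsub hh2 (hlie hφ) (hlie hψ)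
  have hint := integrable_weakPoisson φ ψ
  have hmem : ∀ᵐ z ∂(volume.restrict D), z ∈ D := ae_restrict_mem hD.measurableSet
  have hL : Tendsto (fun k => ∫ z in D, (χ k z : ℂ) * weakPoisson φ ψ z) atTop
      (𝓝 (∫ z in D, weakPoisson φ ψ z)) := by
    refine tendsto_integral_of_dominated_convergence (fun z => ‖weakPoisson φ ψ z‖)
      (fun k => ?_) hint.norm (fun k => ?_) ?_
    · obtain ⟨⟨C, hC⟩, -⟩ := hχ k
      exact (Complex.continuous_ofReal.comp hC.continuous).aestronglyMeasurable.mul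
        hint.aestronglyMeasurable
    · filter_upwards [hmem] with z hz
      rw [norm_mul, Complex.norm_real]
      exact mul_le_of_le_one_left (norm_nonneg _) (hχb k z hz).1
    · filter_upwards [hmem] with z hz
      refine tendsto_const_nhds.congr' ?_
      filter_upwards [hχlim z hz] with k hk
      rw [hk.1, Complex.ofReal_one, one_mul]
  have hR : Tendsto (fun k => ∫ z in D, weakPoisson φ ψ z * (poisson (χ k) h z : ℂ)) atTop
      (𝓝 (∫ z in D, (0 : ℂ))) := by
    refine tendsto_integral_of_dominated_convergence (fun z => ‖weakPoisson φ ψ z‖)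
      (fun k => hint.aestronglyMeasurable.mul ?_) hint.norm (fun k => ?_) ?_
    · refine Complex.continuous_ofReal.comp_aestronglyMeasurable ?_
      rw [poisson_eq_neg_sum_hamComp]
      exact (Finset.measurable_sum _ fun i _ => (((measurable_partialD _).const_mul _).mul
        (measurable_partialD i)).neg).aestronglyMeasurable
    · filter_upwards [hmem] with z hz
      rw [norm_mul, Complex.norm_real, hpois k z hz]
      exact mul_le_of_le_one_right (norm_nonneg _) (hχb k z hz).2
    · filter_upwards [hmem] with z hz
      refine tendsto_const_nhds.congr' ?_
      filter_upwards [hχlim z hz] with k hk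
      rw [hpois k z hz, hk.2, Complex.ofReal_zero, mul_zero]
  rw [integral_zero] at hR
  have hlim := hL.const_mul (κ + μ)
  simp only [hkey] at hlim
  have h0 := tendsto_nhds_unique hlim hR.neg
  rw [neg_zero] at h0
  rw [omega_eq_integral_weakPoisson]
  exact (mul_eq_zero.1 h0).resolve_left hne

theorem omega_eq_zero_of_isRegion (hf : DynamicsAssumption f) (hl : CostAssumption l)
    (hu : MinimizerAssumption f l us) (hD : IsRegion f l us D)
    {κ μ : ℂ} {φ ψ : W12 D} (hφ : IsEigenfunction (pontryaginField f l us) D κ φ)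
    (hψ : IsEigenfunction (pontryaginField f l us) D μ ψ) (hne : κ + μ ≠ 0) :
    omega φ ψ = 0 := by
  rcases hD with rfl | ⟨hopen, hc, hsol⟩
  · exact omega_eq_zero_of_univ φ ψ
  · exact omega_eq_zero_of_invariant hf hl hu hopen hc hsol hφ hψ hne

end Orthogonality

/-! ### Counting mirrored pairs by linear algebra -/

section MirroredPairs

/-- A choice of one element from each pair `{κ, -κ}` with `κ ≠ 0`. -/
def positiveHalf : Set ℂ := {κ | 0 < κ.re ∨ (κ.re = 0 ∧ 0 < κ.im)}

theorem neg_notMem_positiveHalf {κ : ℂ} (h : κ ∈ positiveHalf) : -κ ∉ positiveHalf := by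
  simp only [positiveHalf, mem_ofPred_eq, Complex.neg_re, Complex.neg_im] at h ⊢
  rintro (h' | ⟨h1', h2'⟩) <;> rcases h with h | ⟨h1, h2⟩ <;> linarith

theorem mem_positiveHalf_or_neg {κ : ℂ} (h : κ ≠ 0) : κ ∈ positiveHalf ∨ -κ ∈ positiveHalf := by
  simp only [positiveHalf, mem_ofPred_eq, Complex.neg_re, Complex.neg_im]
  rcases lt_trichotomy κ.re 0 with h1 | h1 | h1
  · exact Or.inr (Or.inl (by linarith))
  · rcases lt_trichotomy κ.im 0 with h2 | h2 | h2
    · exact Or.inr (Or.inr ⟨by simp [h1], by linarith⟩)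
    · exact absurd (Complex.ext h1 h2) h
    · exact Or.inl (Or.inr ⟨h1, h2⟩)
  · exact Or.inl (Or.inl h1)

/-- A system of linear functionals which separates points, indexed by a set of complex numbers, and
supported on the mirrored pairs of that set, forces many mirrored pairs. -/
theorem exists_mirrored_pairs {n : ℕ} {σ : Set ℂ} {W : ℂ → Fin n ⊕ Fin n → ℂ}
    (hW : ∀ κ ∈ σ, W κ ≠ 0 → κ ≠ 0 ∧ -κ ∈ σ)
    (hinj : ∀ c : Fin n ⊕ Fin n → ℂ, (∀ κ ∈ σ, ∑ j, c j * W κ j = 0) → c = 0) :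
    ∃ κp κm : Fin n → ℂ, (∀ i, κp i ∈ σ ∧ κm i ∈ σ ∧ κp i = -κm i ∧ 0 ≤ (κp i).re) ∧
      Function.Injective (Sum.elim κp κm) := by
  set S : Set ℂ := {κ | κ ∈ σ ∧ -κ ∈ σ ∧ κ ∈ positiveHalf} with hS
  have hcard : (n : ℕ∞) ≤ S.encard := by
    by_contra! hlt
    have hfin : S.Finite := encard_lt_top_iff.1 (hlt.trans (ENat.natCast_lt_top n))
    have hT : (S ∪ -S).Finite := hfin.union hfin.neg
    have := hT.fintype
    -- Only the κ in S ∪ -S have W κ ≠ 0, so evaluation there is already injective. This forces 2n ≤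
    -- |S ∪ -S| ≤ 2|S|, contradicting |S| < n.
    let A : (Fin n ⊕ Fin n → ℂ) →ₗ[ℂ] ((S ∪ -S : Set ℂ) → ℂ) :=
      Matrix.mulVecLin (Matrix.of fun κ j => W κ j)
    have hA : Function.Injective A := by
      rw [← LinearMap.ker_eq_bot, LinearMap.ker_eq_bot']
      intro c hc
      refine hinj c fun κ hκ => ?_
      by_cases hz : W κ = 0
      · simp [hz]
      · obtain ⟨hκ0, hκn⟩ := hW κ hκ hz
        have hmem : κ ∈ S ∪ -S := by
          rcases mem_positiveHalf_or_neg hκ0 with h | h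
          · exact Or.inl ⟨hκ, hκn, h⟩
          · exact Or.inr ⟨hκn, by rwa [neg_neg], h⟩
        have := congrFun hc ⟨κ, hmem⟩
        simpa [A, Matrix.mulVec, dotProduct, mul_comm] using this
    have hle := LinearMap.finrank_le_finrank_of_injective hA
    simp only [Module.finrank_fintype_fun_eq_card, Fintype.card_sum, Fintype.card_fin] at hle
    rw [← Nat.card_eq_fintype_card, Nat.card_coe_set_eq] at hle
    have h1 := ncard_union_le S (-S)
    have h2 : (-S).ncard = S.ncard := by
      rw [← image_neg_eq_neg, ncard_image_of_injective _ neg_injective]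
    have h3 : S.ncard < n := by
      rw [← hfin.cast_ncard_eq] at hlt
      exact_mod_cast hlt
    omega
  obtain ⟨t, htS, ht⟩ := exists_subset_encard_eq hcard
  have htn : Nat.card t = n := by
    rw [Nat.card_coe_set_eq, ncard_def, ht]
    rfl
  have : Finite t := finite_of_encard_eq_coe ht
  let e := Finite.equivFinOfCardEq htn
  have hmem : ∀ i, (e.symm i : ℂ) ∈ S := fun i => htS (e.symm i).2
  have hinj' : Function.Injective fun i => (e.symm i : ℂ) :=
    Subtype.val_injective.comp e.symm.injective
  refine ⟨fun i => e.symm i, fun i => -e.symm i,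
    fun i => ⟨(hmem i).1, (hmem i).2.1, (neg_neg _).symm, ?_⟩, ?_⟩
  · rcases (hmem i).2.2 with h | h
    · exact h.le
    · exact h.1.ge
  · refine hinj'.sumElim (neg_injective.comp hinj') fun i j h => ?_
    exact neg_notMem_positiveHalf (hmem j).2.2 (h ▸ (hmem i).2.2)

end MirroredPairs

end PontryaginKoopman

end

/-! ### The main theorem -/

theorem mainTheorem4 (n m : ℕ)
    (f : EuclideanSpace ℝ (Fin n) → EuclideanSpace ℝ (Fin m) → EuclideanSpace ℝ (Fin n))
    (l : EuclideanSpace ℝ (Fin n) → EuclideanSpace ℝ (Fin m) → ℝ)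
    (us : EuclideanSpace ℝ (Fin n) → EuclideanSpace ℝ (Fin n) → EuclideanSpace ℝ (Fin m))
    (hf : PontryaginKoopman.DynamicsAssumption f)
    (hl : PontryaginKoopman.CostAssumption l)
    (hu : PontryaginKoopman.MinimizerAssumption f l us)
    (D : Set (PontryaginKoopman.Phase n))
    (hD : PontryaginKoopman.IsRegion f l us D)
    (q : Fin n ⊕ Fin n → PontryaginKoopman.W12 D)
    (hq : PontryaginKoopman.IsSkewOrthogonal q)
    (hdec : PontryaginKoopman.AdmitsSpectralDecomposition
      (PontryaginKoopman.pontryaginField f l us) D q) :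
    ∃ κp κm : Fin n → ℂ,
      (∀ i, κp i ∈ PontryaginKoopman.pointSpectrum (PontryaginKoopman.pontryaginField f l us) D ∧
        κm i ∈ PontryaginKoopman.pointSpectrum (PontryaginKoopman.pontryaginField f l us) D ∧
        κp i = -κm i ∧ 0 ≤ (κp i).re) ∧
      Function.Injective (Sum.elim κp κm) := by
  obtain ⟨Ψ, a, hΨ, ha, hdec⟩ := hdec
  set σ := PontryaginKoopman.pointSpectrum (PontryaginKoopman.pontryaginField f l us) D with hσ
  have hae : ∀ j, ∀ᵐ κ ∂(a j).variation, κ ∈ σ := fun j => ha j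
  -- The measures are carried by σ, so a functional that annihilates every chosen eigenfunction
  -- annihilates q. Both conditions on W below are instances of this.
  have hvanish : ∀ (ℓ : PontryaginKoopman.W12 D →L[ℂ] ℂ), (∀ κ ∈ σ, ℓ (Ψ κ) = 0) →
      ∀ j, ℓ (q j) = 0 := fun ℓ h j => by
    rw [(hdec j ℓ).2]
    exact VectorMeasure.integral_eq_zero_of_ae ((hae j).mono fun κ hκ => h κ hκ)
  choose W hW using PontryaginKoopman.exists_omega_functional (D := D)
  refine PontryaginKoopman.exists_mirrored_pairs (W := fun κ j => W (Ψ κ) (q j))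
    (fun κ hκ hne => ?_) fun c hc => ?_
  · by_contra hcon
    refine hne (funext fun j => hvanish _ (fun μ hμ => ?_) j)
    rw [hW]
    -- The only μ that could contribute is -κ. If it is not an available mirror partner then κ = 0,
    -- and the pairing is of the single chosen eigenfunction with itself.
    by_cases hsum : κ + μ = 0
    · have hμκ : μ = -κ := eq_neg_of_add_eq_zero_right hsum
      have hκ0 : κ = 0 := by
        by_contra h0
        exact hcon ⟨h0, hμκ ▸ hμ⟩
      rw [hμκ, hκ0, neg_zero]
      exact PontryaginKoopman.omega_self _
    · exact PontryaginKoopman.omega_eq_zero_of_isRegion hf hl hu hD (hΨ κ hκ) (hΨ μ hμ) hsum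
  · have hℓ : ∀ φ, (∑ j, c j • W (q j)) φ = -∑ j, c j * W φ (q j) := fun φ => by
      simp only [_root_.sum_apply, _root_.smul_apply, smul_eq_mul, hW,
        ← Finset.sum_neg_distrib]
      exact Finset.sum_congr rfl fun j _ => by
        rw [PontryaginKoopman.omega_antisymm (q j), mul_neg]
    have h0 := hvanish (∑ j, c j • W (q j)) fun κ hκ => by rw [hℓ, hc κ hκ, neg_zero]
    ext i
    -- Row `i.swap` of Ω has its only nonzero entry, ±1, in column i, so pairing with this component
    -- of q isolates the coefficient `c i`.
    have hi := h0 i.swap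
    rw [hℓ] at hi
    simp only [hW, hq i.swap, PontryaginKoopman.Omega_eq, Sum.swap_swap, mul_ite, mul_zero,
      Finset.sum_ite_eq', Finset.mem_univ, if_true, neg_eq_zero, mul_eq_zero] at hi
    refine hi.resolve_right ?_
    cases i <;> simp [PontryaginKoopman.coordSign]
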